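/- **Theorem 1.2.** For real $x \ge 2$ let $$F(x)=\sum_{1\le n\le x}\frac{1}{\tau(n^2+1)},$$ where the sum is over positive integers $n$ and $\tau(m)=\sum_{d\mid m}1$ is the number of positive divisors of $m$. Then $$F(x)\asymp \frac{x}{(\log x)^{1/2}},$$ that is, there are absolute constants $c, C>0$ such that for all real $x\ge 2$ $$c\,\frac{x}{(\log x)^{1/2}}\le F(x)\le C\,\frac{x}{(\log x)^{1/2}}.$$ -/

import Mathlib

/-- `F x` is the sum over positive integers `n ≤ x` of the reciprocal of the number of
positive divisors of `n ^ 2 + 1`. -/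
noncomputable def F (x : ℝ) : ℝ :=
  ∑ n ∈ Finset.Icc 1 ⌊x⌋₊, 1 / ((n ^ 2 + 1).divisors.card : ℝ)

/-! ### Mertens-type estimates for `Λ`, plain and twisted by the character modulo 4. -/

section Mertens

open Finset ArithmeticFunction

/-! Put z = 2^(2^t), with t chosen so that z lies between two fixed small powers of x. Since n^2+1
has only boundedly many prime factors above z, 1/τ(n^2+1) is governed by the primes p < z dividing
n^2+1.

For the upper bound, τ(m) is at least 2 to the number of primes p < z dividing m, so 1/τ is at most
a product of local factors 1 or 1/2. For the lower bound, integers with p^2 dividing n^2+1 for some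
p < z are discarded by making that local factor 0; on the rest 1/τ is at least a constant times the
same product. Both products have the form ∏(1 - `localWeight θ n p`), with θ = 0 and θ = 1/2
(`one_div_card_divisors_le`, `prod_one_sub_localWeight_half_le`).

The mean of such a product is found by a sieve with real weights in [0,1]. A prime p ≡ 1 mod 4 has
two roots of a^2+1, so its mean weight is 1/p + O(1/p^2); primes p ≡ 3 have none. Mertens' theorem
for p ≡ 1 mod 4, which rests on L(1,χ) > 0, gives ∏(1 - `localDensity θ p`) ≍ 2^(-t/2) ≍ (log
x)^(-1/2). The Brun-Hooley sieve (`brunHooley`), applied to the layers 2^(2^i) ≤ p < 2^(2^(i+1)),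
shows that the sum over n ≤ N has the order of N times this product
(`exists_sum_prod_one_sub_localWeight_bounds`). -/

theorem abs_sum_mul_antitone_le {c f : ℕ → ℝ} {B : ℝ} {k : ℕ}
    (hc : ∀ n, k ≤ n → |∑ i ∈ Ico k n, c i| ≤ B)
    (hf : ∀ n, k ≤ n → f (n + 1) ≤ f n) (hf0 : ∀ n, k ≤ n → 0 ≤ f n) {n : ℕ} (hn : k ≤ n) :
    |∑ i ∈ Ico k n, c i * f i| ≤ B * f k := by
  -- Summation by parts as an invariant: each step adds a partial sum of `c`, at most `B` in size,
  -- times the drop of `f`, and the drops telescope.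
  have key : |∑ i ∈ Ico k n, c i * f i - (∑ i ∈ Ico k n, c i) * f n| ≤ B * (f k - f n) := by
    induction n, hn using Nat.le_induction with
    | base => simp
    | succ n hn ih =>
      have h1 := hc (n + 1) (by omega)
      rw [sum_Ico_succ_top hn] at h1
      rw [sum_Ico_succ_top hn, sum_Ico_succ_top hn]
      have e : ∑ i ∈ Ico k n, c i * f i + c n * f n - (∑ i ∈ Ico k n, c i + c n) * f (n + 1)
          = (∑ i ∈ Ico k n, c i * f i - (∑ i ∈ Ico k n, c i) * f n)
            + (∑ i ∈ Ico k n, c i + c n) * (f n - f (n + 1)) := by ring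
      rw [e]
      refine (abs_add_le _ _).trans ?_
      rw [abs_mul, abs_of_nonneg (sub_nonneg.2 (hf n hn))]
      have := mul_le_mul_of_nonneg_right h1 (sub_nonneg.2 (hf n hn))
      linarith
  have h2 := mul_le_mul_of_nonneg_right (hc n hn) (hf0 n hn)
  have h3 : |(∑ i ∈ Ico k n, c i) * f n| ≤ B * f n := by
    rwa [abs_mul, abs_of_nonneg (hf0 n hn)]
  have h4 := abs_add_le (∑ i ∈ Ico k n, c i * f i - (∑ i ∈ Ico k n, c i) * f n)
    ((∑ i ∈ Ico k n, c i) * f n)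
  rw [sub_add_cancel] at h4
  linarith

/-- The nontrivial Dirichlet character modulo `4`, with real values. -/
noncomputable def chi (n : ℕ) : ℝ := ((ZMod.χ₄ (n : ZMod 4) : ℤ) : ℝ)

theorem chi_mul (m n : ℕ) : chi (m * n) = chi m * chi n := by
  unfold chi
  rw [Nat.cast_mul, map_mul, Int.cast_mul]

theorem chi_eq (n : ℕ) : chi n = if n % 2 = 0 then 0 else if n % 4 = 1 then 1 else -1 := by
  unfold chi
  rw [ZMod.χ₄_nat_eq_if_mod_four]
  split_ifs <;> simp

theorem abs_chi_le (n : ℕ) : |chi n| ≤ 1 := by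
  rw [chi_eq]; split_ifs <;> simp

theorem abs_sum_chi_le (k n : ℕ) : |∑ i ∈ Ico k n, chi i| ≤ 1 := by
  have h : ∀ m, ∑ i ∈ range m, chi i = if m % 4 = 2 ∨ m % 4 = 3 then 1 else 0 := by
    intro m
    induction m with
    | zero => simp
    | succ m ih =>
      rw [sum_range_succ, ih, chi_eq]
      have : m % 4 < 4 := Nat.mod_lt _ (by norm_num)
      have e2 : m % 2 = (m % 4) % 2 := by omega
      have e3 : (m + 1) % 4 = (m % 4 + 1) % 4 := by omega
      rw [e2, e3]
      generalize m % 4 = r at *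
      interval_cases r <;> norm_num
  rcases le_or_gt k n with hkn | hkn
  · rw [sum_Ico_eq_sub _ hkn, h, h]
    split_ifs <;> norm_num
  · rw [Ico_eq_empty (by omega)]; simp

theorem Ioc_zero_eq_Ico (N : ℕ) : Ioc 0 N = Ico 1 (N + 1) := by
  ext; simp; omega

/-- The value at `1` of the Dirichlet `L`-series of `chi`. -/
theorem exists_sum_chi_div :
    ∃ l : ℝ, 0 < l ∧ ∀ N : ℕ, |∑ m ∈ Ioc 0 N, chi m / m - l| ≤ 1 / (N + 1) := by
  have tail : ∀ k n : ℕ, 0 < k → k ≤ n → |∑ m ∈ Ico k n, chi m / m| ≤ 1 / k := by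
    intro k n hk hkn
    have := abs_sum_mul_antitone_le (c := chi) (f := fun m : ℕ => 1 / (m : ℝ)) (B := 1) (k := k)
      (fun n _ => abs_sum_chi_le k n)
      (fun n hn => by
        have : (0 : ℝ) < n := by exact_mod_cast hk.trans_le hn
        push_cast
        gcongr
        linarith)
      (fun n _ => by positivity) hkn
    simpa [div_eq_mul_inv] using this
  have hdiff : ∀ N M : ℕ, N ≤ M →
      |∑ m ∈ Ioc 0 M, chi m / m - ∑ m ∈ Ioc 0 N, chi m / m| ≤ 1 / (N + 1) := by
    intro N M h
    rw [Ioc_zero_eq_Ico, Ioc_zero_eq_Ico, ← sum_Ico_consecutive _ (by omega : 1 ≤ N + 1)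
      (by omega : N + 1 ≤ M + 1), add_sub_cancel_left]
    simpa using tail (N + 1) (M + 1) (by omega) (by omega)
  have hcs : CauchySeq fun N : ℕ => ∑ m ∈ Ioc 0 N, chi m / m := by
    refine cauchySeq_of_le_tendsto_0' (fun N : ℕ => 1 / ((N : ℝ) + 1)) (fun N M h => ?_)
      tendsto_one_div_add_atTop_nhds_zero_nat
    rw [dist_comm, Real.dist_eq]
    exact hdiff N M h
  obtain ⟨l, hl⟩ := cauchySeq_tendsto_of_complete hcs
  have hb : ∀ N : ℕ, |l - ∑ m ∈ Ioc 0 N, chi m / m| ≤ 1 / (N + 1) := fun N =>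
    le_of_tendsto ((hl.sub_const _).abs)
      (Filter.eventually_atTop.2 ⟨N, fun M h => hdiff N M h⟩)
  refine ⟨l, ?_, fun N => by rw [abs_sub_comm]; exact hb N⟩
  -- Positivity needs only N = 1: the partial sum is 1 and the tail is at most 1/2.
  have h3 := (abs_le.1 (hb 1)).1
  have e : ∑ m ∈ Ioc 0 1, chi m / m = 1 := by
    simp [chi_eq]
  rw [e] at h3
  norm_num at h3
  linarith

theorem abs_sum_chi_mul_log_div_le :
    ∃ C : ℝ, ∀ N : ℕ, |∑ m ∈ Ioc 0 N, chi m * Real.log m / m| ≤ C := by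
  refine ⟨1 + 1, fun N => ?_⟩
  -- log m / m decreases only from e onwards, hence the start at 3; the terms m = 1, 2 vanish
  -- because log 1 = 0 and χ(2) = 0.
  have tail : ∀ n : ℕ, 3 ≤ n → |∑ m ∈ Ico 3 n, chi m * Real.log m / m| ≤ 1 := by
    intro n hn
    have h := abs_sum_mul_antitone_le (c := chi) (f := fun m : ℕ => Real.log m / (m : ℝ))
      (B := 1) (k := 3) (fun n _ => abs_sum_chi_le 3 n)
      (fun n hn => by
        have h3 : Real.exp 1 ≤ (n : ℝ) := by
          have := Real.exp_one_lt_d9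
          have : (3 : ℝ) ≤ n := by exact_mod_cast hn
          linarith
        refine Real.log_div_self_antitoneOn h3 ?_ ?_
        · simp only [Set.mem_Ici]; push_cast; linarith
        · push_cast; linarith)
      (fun n _ => div_nonneg (Real.log_natCast_nonneg n) (Nat.cast_nonneg n)) hn
    have h1 : Real.log 3 / 3 ≤ 1 := by
      have := Real.log_le_sub_one_of_pos (show (0 : ℝ) < 3 by norm_num)
      rw [div_le_one (by norm_num)]; linarith
    simp only [Nat.cast_ofNat, one_mul, ← mul_div_assoc] at h
    exact h.trans h1
  rw [Ioc_zero_eq_Ico]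
  rcases lt_or_ge (N + 1) 3 with h | h
  · have : N = 0 ∨ N = 1 := by omega
    rcases this with rfl | rfl <;> norm_num
  · rw [← sum_Ico_consecutive _ (by norm_num : 1 ≤ 3) h]
    have h0 : ∑ m ∈ Ico 1 3, chi m * Real.log m / m = 0 := by
      rw [sum_Ico_succ_top (by norm_num), sum_Ico_succ_top (by norm_num)]
      simp [chi_eq]
    rw [h0, zero_add]
    linarith [tail _ h]

theorem psi_natCast_le (N : ℕ) : ∑ d ∈ Ioc 0 N, Λ d ≤ (Real.log 4 + 4) * N := by
  simpa [Chebyshev.psi] using Chebyshev.psi_le_const_mul_self (Nat.cast_nonneg (α := ℝ) N)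

/-- Twisting Λ * 1 = log by χ(n)/n writes the bounded sum of χ(n) log n / n as a sum of χ(n)Λ(n)/n
times partial sums of L(1,χ). Each partial sum is L(1,χ) + O(n/N), so the total error is O(ψ(N)/N) =
O(1), and L(1,χ) > 0 can be divided out. -/
theorem exists_abs_sum_chi_mul_vonMangoldt_div_le :
    ∃ C : ℝ, ∀ N : ℕ, |∑ n ∈ Ioc 0 N, chi n * Λ n / n| ≤ C := by
  obtain ⟨l, hl, hL⟩ := exists_sum_chi_div
  obtain ⟨C, hC⟩ := abs_sum_chi_mul_log_div_le
  refine ⟨(C + (Real.log 4 + 4)) / l, fun N => ?_⟩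
  let a : ArithmeticFunction ℝ := ⟨fun n => chi n * Λ n / n, by simp⟩
  let b : ArithmeticFunction ℝ := ⟨fun n => chi n / n, by simp⟩
  have hab : ∀ n : ℕ, (a * b) n = chi n * Real.log n / n := by
    intro n
    rw [mul_apply, ← vonMangoldt_sum, Nat.sum_divisorsAntidiagonal (f := fun i j => a i * b j),
      mul_sum, sum_div]
    refine sum_congr rfl fun d hd => ?_
    have hd' := Nat.dvd_of_mem_divisors hd
    have hn : n ≠ 0 := (Nat.mem_divisors.1 hd).2
    obtain ⟨e, rfl⟩ := hd'
    have hd0 : d ≠ 0 := by rintro rfl; simp at hn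
    have he0 : e ≠ 0 := by rintro rfl; simp at hn
    rw [Nat.mul_div_cancel_left _ (Nat.pos_of_ne_zero hd0)]
    simp only [a, b, coe_mk, chi_mul]
    have : (d : ℝ) ≠ 0 := by exact_mod_cast hd0
    have : (e : ℝ) ≠ 0 := by exact_mod_cast he0
    push_cast
    field_simp
  have hsum := sum_Ioc_mul_eq_sum_sum a b N
  simp only [hab] at hsum
  have hsplit : l * ∑ n ∈ Ioc 0 N, chi n * Λ n / n
      = ∑ n ∈ Ioc 0 N, chi n * Real.log n / n
        - ∑ n ∈ Ioc 0 N, a n * (∑ m ∈ Ioc 0 (N / n), b m - l) := by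
    rw [hsum, ← sum_sub_distrib, mul_sum]
    refine sum_congr rfl fun n _ => ?_
    simp only [a, coe_mk]; ring
  have herr : |∑ n ∈ Ioc 0 N, a n * (∑ m ∈ Ioc 0 (N / n), b m - l)| ≤ Real.log 4 + 4 := by
    rcases Nat.eq_zero_or_pos N with rfl | hN
    · simp; positivity
    have hN' : (0 : ℝ) < N := by exact_mod_cast hN
    refine (abs_sum_le_sum_abs _ _).trans ?_
    calc ∑ n ∈ Ioc 0 N, |a n * (∑ m ∈ Ioc 0 (N / n), b m - l)|
        ≤ ∑ n ∈ Ioc 0 N, Λ n / N := by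
          refine sum_le_sum fun n hn => ?_
          have hn0 : (0 : ℝ) < n := by exact_mod_cast (mem_Ioc.1 hn).1
          rw [abs_mul]
          have h1 : |a n| ≤ Λ n / n := by
            simp only [a, coe_mk, abs_div, abs_mul, Nat.abs_cast, abs_of_nonneg vonMangoldt_nonneg]
            gcongr
            calc |chi n| * Λ n ≤ 1 * Λ n :=
                  mul_le_mul_of_nonneg_right (abs_chi_le n) vonMangoldt_nonneg
              _ = Λ n := one_mul _
          have h2 : |∑ m ∈ Ioc 0 (N / n), b m - l| ≤ n / N := by
            refine (hL (N / n)).trans ?_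
            rw [div_le_div_iff₀ (by positivity) hN', one_mul]
            have : N < n * (N / n + 1) := by
              rw [mul_comm]
              exact Nat.lt_mul_of_div_lt (Nat.lt_succ_self _) (mem_Ioc.1 hn).1
            exact_mod_cast this.le
          calc |a n| * |∑ m ∈ Ioc 0 (N / n), b m - l| ≤ (Λ n / n) * (n / N) :=
                mul_le_mul h1 h2 (abs_nonneg _) (div_nonneg vonMangoldt_nonneg hn0.le)
            _ = Λ n / N := by field_simp
      _ ≤ Real.log 4 + 4 := by
          rw [← sum_div, div_le_iff₀ hN']
          exact psi_natCast_le N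
  have h5 : |l * ∑ n ∈ Ioc 0 N, chi n * Λ n / n| ≤ C + (Real.log 4 + 4) := by
    rw [hsplit]
    refine (abs_sub _ _).trans ?_
    exact add_le_add (hC N) herr
  rw [abs_mul, abs_of_pos hl] at h5
  rw [le_div_iff₀ hl]
  linarith

/-- Mertens' first theorem: compare log N! = ∑ Λ(n)⌊N/n⌋ with N log N + O(N), the rounding costing
at most ψ(N) = O(N). -/
theorem exists_abs_sum_vonMangoldt_div_sub_log_le :
    ∃ C : ℝ, ∀ N : ℕ, 0 < N → |∑ n ∈ Ioc 0 N, Λ n / n - Real.log N| ≤ C := by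
  refine ⟨Real.log 4 + 4 + 1, fun N hN => ?_⟩
  have hN' : (0 : ℝ) < N := by exact_mod_cast hN
  have hfac : ∑ n ∈ Ioc 0 N, Λ n * ((N / n : ℕ) : ℝ) = Real.log (N.factorial) := by
    rw [← sum_Ioc_mul_zeta_eq_sum, vonMangoldt_mul_zeta]
    clear hN hN'
    induction N with
    | zero => simp
    | succ N ih =>
      rw [sum_Ioc_succ_top (Nat.zero_le N), ih, Nat.factorial_succ, Nat.cast_mul,
        Real.log_mul (by positivity) (by positivity), log_apply, add_comm]
  have hup : Real.log (N.factorial) ≤ N * Real.log N := by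
    rw [← Real.log_pow]
    exact Real.log_le_log (by positivity) (by exact_mod_cast Nat.factorial_le_pow N)
  have hlow : N * Real.log N - N ≤ Real.log (N.factorial) := by
    have h := Real.pow_div_factorial_le_exp _ hN'.le N
    rw [div_le_iff₀ (by positivity)] at h
    have h' := Real.log_le_log (by positivity) h
    rw [Real.log_pow, Real.log_mul (by positivity) (by positivity), Real.log_exp] at h'
    linarith
  have e1 : ∑ n ∈ Ioc 0 N, Λ n * ((N / n : ℕ) : ℝ) ≤ N * ∑ n ∈ Ioc 0 N, Λ n / n := by
    rw [mul_sum]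
    refine sum_le_sum fun n hn => ?_
    calc Λ n * ((N / n : ℕ) : ℝ) ≤ Λ n * (N / n) :=
          mul_le_mul_of_nonneg_left Nat.cast_div_le vonMangoldt_nonneg
      _ = _ := by ring
  have e2 : N * ∑ n ∈ Ioc 0 N, Λ n / n
      ≤ ∑ n ∈ Ioc 0 N, Λ n * ((N / n : ℕ) : ℝ) + (Real.log 4 + 4) * N := by
    refine le_trans ?_ (add_le_add_right (psi_natCast_le N) _)
    rw [mul_sum, ← sum_add_distrib]
    refine sum_le_sum fun n hn => ?_
    have hn0 : (0 : ℝ) < n := by exact_mod_cast (mem_Ioc.1 hn).1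
    have hlt : (N : ℝ) / n ≤ ((N / n : ℕ) : ℝ) + 1 := by
      rw [div_le_iff₀ hn0]
      exact_mod_cast (Nat.lt_mul_of_div_lt (Nat.lt_succ_self _) (mem_Ioc.1 hn).1).le
    calc N * (Λ n / n) = Λ n * (N / n) := by ring
      _ ≤ Λ n * (((N / n : ℕ) : ℝ) + 1) := mul_le_mul_of_nonneg_left hlt vonMangoldt_nonneg
      _ = _ := by ring
  rw [hfac] at e1 e2
  have hl4 : 0 ≤ Real.log 4 := Real.log_nonneg (by norm_num)
  rw [abs_le]
  constructor
  · refine le_of_mul_le_mul_left ?_ hN'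
    nlinarith
  · refine le_of_mul_le_mul_left ?_ hN'
    nlinarith

end Mertens

/-! ### Sums of reciprocals of primes congruent to 1 modulo 4. -/

section MertensPrimes

open Finset ArithmeticFunction

theorem exists_abs_sum_inv_mul_log_sub_log_log_le :
    ∃ C : ℝ, ∀ N : ℕ, 2 ≤ N →
      |∑ n ∈ Ico 2 N, 1 / ((n : ℝ) * Real.log n) - Real.log (Real.log N)| ≤ C := by
  -- The increment of log log is caught between consecutive terms by applying 1 - 1/y ≤ log y ≤ y -
  -- 1 twice, so the sum telescopes.
  have hstep : ∀ n : ℕ, 2 ≤ n →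
      1 / (((n + 1 : ℕ) : ℝ) * Real.log (n + 1 : ℕ))
        ≤ Real.log (Real.log (n + 1 : ℕ)) - Real.log (Real.log n) ∧
      Real.log (Real.log (n + 1 : ℕ)) - Real.log (Real.log n) ≤ 1 / ((n : ℝ) * Real.log n) := by
    intro n hn
    have hn0 : (0 : ℝ) < n := by exact_mod_cast (by omega : 0 < n)
    have hb : 0 < Real.log n := Real.log_pos (by exact_mod_cast (by omega : 1 < n))
    have ha : 0 < Real.log (n + 1 : ℕ) := Real.log_pos (by exact_mod_cast (by omega : 1 < n + 1))
    have hs0 : (0 : ℝ) < (n + 1 : ℕ) := by positivity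
    rw [← Real.log_div ha.ne' hb.ne']
    constructor
    · refine le_trans ?_ (Real.one_sub_inv_le_log_of_pos (div_pos ha hb))
      have h := Real.one_sub_inv_le_log_of_pos (div_pos hs0 hn0)
      rw [Real.log_div hs0.ne' hn0.ne', inv_div] at h
      rw [inv_div, one_sub_div ha.ne', one_div, mul_inv, ← div_eq_mul_inv]
      gcongr
      refine le_trans (le_of_eq ?_) h
      push_cast at hs0 ⊢
      field_simp
      ring
    · refine (Real.log_le_sub_one_of_pos (div_pos ha hb)).trans ?_
      have h := Real.log_le_sub_one_of_pos (div_pos hs0 hn0)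
      rw [Real.log_div hs0.ne' hn0.ne'] at h
      rw [div_sub_one hb.ne', one_div, mul_inv, ← div_eq_mul_inv]
      gcongr
      refine h.trans (le_of_eq ?_)
      push_cast
      field_simp
      ring
  have hmain : ∀ N : ℕ, 2 ≤ N →
      - Real.log (Real.log 2) ≤ ∑ n ∈ Ico 2 N, 1 / ((n : ℝ) * Real.log n)
        - Real.log (Real.log N) ∧
      ∑ n ∈ Ico 2 N, 1 / ((n : ℝ) * Real.log n) - Real.log (Real.log N)
        ≤ 1 / (2 * Real.log 2) - Real.log (Real.log 2) - 1 / ((N : ℝ) * Real.log N) := by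
    intro N hN
    induction N, hN using Nat.le_induction with
    | base => simp
    | succ n hn ih =>
      rw [sum_Ico_succ_top hn]
      have := hstep n hn
      constructor <;> linarith
  refine ⟨|Real.log (Real.log 2)| + 1 / (2 * Real.log 2), fun N hN => ?_⟩
  obtain ⟨h1, h2⟩ := hmain N hN
  have h3 : 0 ≤ 1 / ((N : ℝ) * Real.log N) :=
    one_div_nonneg.2 (mul_nonneg (Nat.cast_nonneg _) (Real.log_natCast_nonneg _))
  have h4 : 0 ≤ 1 / (2 * Real.log 2) := by
    have := Real.log_pos one_lt_two
    positivity
  have h5 := le_abs_self (Real.log (Real.log 2))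
  have h6 := neg_abs_le (Real.log (Real.log 2))
  rw [abs_le]
  constructor <;> linarith

theorem abs_sum_inv_sub_log_le (N : ℕ) (hN : 0 < N) :
    |∑ n ∈ Ioc 0 N, 1 / (n : ℝ) - Real.log N| ≤ 1 := by
  have e : ∑ n ∈ Ioc 0 N, 1 / (n : ℝ) = (harmonic N : ℝ) := by
    rw [harmonic_eq_sum_Icc]
    push_cast
    exact sum_congr (by ext; simp; omega) fun _ _ => by simp
  have h1 := log_add_one_le_harmonic N
  have h2 := harmonic_le_one_add_log N
  have h3 : Real.log N ≤ Real.log (N + 1 : ℕ) :=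
    Real.log_le_log (by exact_mod_cast hN) (by push_cast; linarith)
  rw [e, abs_le]
  constructor <;> linarith

theorem exists_abs_sum_one_add_chi_mul_vonMangoldt_sub_le :
    ∃ C : ℝ, ∀ N : ℕ, 2 ≤ N →
      |∑ n ∈ Ico 2 N, ((1 + chi n) * Λ n / n - 1 / (n : ℝ))| ≤ C := by
  obtain ⟨C₁, h₁⟩ := exists_abs_sum_chi_mul_vonMangoldt_div_le
  obtain ⟨C₂, h₂⟩ := exists_abs_sum_vonMangoldt_div_sub_log_le
  refine ⟨C₁ + C₂ + 2, fun N hN => ?_⟩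
  obtain ⟨M, rfl⟩ : ∃ M, N = M + 1 := ⟨N - 1, by omega⟩
  -- The final 1 compensates for the term n = 1, which equals -1 because Λ(1) = 0.
  have e : ∑ n ∈ Ico 2 (M + 1), ((1 + chi n) * Λ n / n - 1 / (n : ℝ))
      = ∑ n ∈ Ioc 0 M, chi n * Λ n / n + (∑ n ∈ Ioc 0 M, Λ n / n - Real.log M)
        - (∑ n ∈ Ioc 0 M, 1 / (n : ℝ) - Real.log M) + 1 := by
    have h := sum_Ico_consecutive (fun n : ℕ => (1 + chi n) * Λ n / n - 1 / (n : ℝ))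
      (by norm_num : 1 ≤ 2) hN
    simp only [Nat.Ico_succ_singleton, sum_singleton, vonMangoldt_apply_one] at h
    rw [← Ioc_zero_eq_Ico, sum_sub_distrib] at h
    simp only [add_mul, one_mul, add_div, sum_add_distrib] at h ⊢
    norm_num [sum_add_distrib] at h ⊢
    linarith
  rw [e]
  have a1 := abs_le.1 (h₁ M)
  have a2 := abs_le.1 (h₂ M (by omega))
  have a3 := abs_le.1 (abs_sum_inv_sub_log_le M (by omega))
  rw [abs_le]
  constructor <;> linarith [a1.1, a1.2]

/-- Partial summation against 1/log n turns the bounded discrepancy between (1+χ(n))Λ(n)/n and 1/n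
into one between the same terms divided by log n. -/
theorem exists_abs_sum_one_add_chi_mul_vonMangoldt_div_log_sub_le :
    ∃ C : ℝ, ∀ N : ℕ, 2 ≤ N →
      |∑ n ∈ Ico 2 N, (1 + chi n) * Λ n / (n * Real.log n) - Real.log (Real.log N)| ≤ C := by
  obtain ⟨C₁, h₁⟩ := exists_abs_sum_one_add_chi_mul_vonMangoldt_sub_le
  obtain ⟨C₂, h₂⟩ := exists_abs_sum_inv_mul_log_sub_log_log_le
  refine ⟨C₁ * (1 / Real.log (2 : ℕ)) + C₂, fun N hN => ?_⟩
  have hlog : ∀ n : ℕ, 2 ≤ n → 0 < Real.log n := fun n hn =>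
    Real.log_pos (by exact_mod_cast (by omega : 1 < n))
  have h := abs_sum_mul_antitone_le (c := fun n : ℕ => (1 + chi n) * Λ n / n - 1 / (n : ℝ))
    (f := fun n : ℕ => 1 / Real.log n) (B := C₁) (k := 2) h₁
    (fun n hn => by
      have := hlog n hn
      have hn0 : (0 : ℝ) < n := by exact_mod_cast (by omega : 0 < n)
      refine one_div_le_one_div_of_le this (Real.log_le_log hn0 ?_)
      push_cast; linarith)
    (fun n hn => (one_div_pos.2 (hlog n hn)).le) hN
  have e : ∑ n ∈ Ico 2 N, (1 + chi n) * Λ n / (n * Real.log n)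
      = ∑ n ∈ Ico 2 N, ((1 + chi n) * Λ n / n - 1 / (n : ℝ)) * (1 / Real.log n)
        + ∑ n ∈ Ico 2 N, 1 / ((n : ℝ) * Real.log n) := by
    rw [← sum_add_distrib]
    refine sum_congr rfl fun n _ => ?_
    rw [sub_mul, div_mul_div_comm, div_mul_div_comm]
    ring
  rw [e, add_sub_assoc]
  exact (abs_add_le _ _).trans (add_le_add h (h₂ N hN))

theorem exists_sum_not_prime_vonMangoldt_div_le :
    ∃ C : ℝ, ∀ s : Finset ℕ, ∑ n ∈ s with ¬ n.Prime, Λ n / (n : ℝ) ≤ C := by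
  -- Modulus 1 makes the residue class all of ℕ, so this is the convergence of ∑ Λ(n)/n over
  -- non-primes.
  have hs := vonMangoldt.summable_residueClass_non_primes_div (q := 1) 0
  refine ⟨∑' n : ℕ, (if n.Prime then 0 else vonMangoldt.residueClass (0 : ZMod 1) n) / n,
    fun s => le_trans (le_of_eq ?_) (hs.sum_le_tsum s fun n _ => ?_)⟩
  · rw [sum_filter]
    refine sum_congr rfl fun n _ => ?_
    have : vonMangoldt.residueClass (0 : ZMod 1) n = Λ n := by
      rw [vonMangoldt.residueClass, Set.indicator_of_mem]
      exact Subsingleton.elim _ _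
    rw [this]
    split_ifs <;> simp_all
  · refine div_nonneg ?_ (Nat.cast_nonneg n)
    split_ifs
    · exact le_rfl
    · exact vonMangoldt.residueClass_nonneg _ _

/-- Mertens' second theorem for primes congruent to `1` modulo `4`. -/
theorem exists_abs_sum_prime_one_mod_four_sub_log_log_le :
    ∃ C : ℝ, ∀ N : ℕ, 2 ≤ N →
      |∑ p ∈ range N with p.Prime ∧ p % 4 = 1, 1 / (p : ℝ) - Real.log (Real.log N) / 2| ≤ C := by
  obtain ⟨C₁, h₁⟩ := exists_abs_sum_one_add_chi_mul_vonMangoldt_div_log_sub_le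
  obtain ⟨C₂, h₂⟩ := exists_sum_not_prime_vonMangoldt_div_le
  have hl2 : 0 < Real.log 2 := Real.log_pos one_lt_two
  refine ⟨(C₁ + 2 * C₂ / Real.log 2 + 1) / 2, fun N hN => ?_⟩
  have hnp0 : 0 ≤ ∑ n ∈ Ico 2 N with ¬ n.Prime, (1 + chi n) * Λ n / (n * Real.log n) := by
    refine sum_nonneg fun n _ => ?_
    have := (abs_le.1 (abs_chi_le n)).1
    exact div_nonneg (mul_nonneg (by linarith) vonMangoldt_nonneg)
      (mul_nonneg (Nat.cast_nonneg _) (Real.log_natCast_nonneg _))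
  have hnp : ∑ n ∈ Ico 2 N with ¬ n.Prime, (1 + chi n) * Λ n / (n * Real.log n)
      ≤ 2 * C₂ / Real.log 2 := by
    calc ∑ n ∈ Ico 2 N with ¬ n.Prime, (1 + chi n) * Λ n / (n * Real.log n)
        ≤ ∑ n ∈ Ico 2 N with ¬ n.Prime, (2 / Real.log 2) * (Λ n / n) := by
          refine sum_le_sum fun n hn => ?_
          have hn2 : 2 ≤ n := (mem_Ico.1 (mem_filter.1 hn).1).1
          have h2n : (2 : ℝ) ≤ n := by exact_mod_cast hn2
          have hlog : Real.log 2 ≤ Real.log n := Real.log_le_log two_pos h2n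
          have := (abs_le.1 (abs_chi_le n)).2
          rw [div_mul_div_comm, mul_comm (n : ℝ)]
          have := @vonMangoldt_nonneg n
          gcongr
          linarith
      _ ≤ (2 / Real.log 2) * C₂ := by
          rw [← mul_sum]
          exact mul_le_mul_of_nonneg_left (h₂ _) (by positivity)
      _ = _ := by ring
  have hp : ∀ n : ℕ, n.Prime → (1 + chi n) * Λ n / (n * Real.log n) = (1 + chi n) / n := by
    intro n hn
    have : Real.log n ≠ 0 := (Real.log_pos (by exact_mod_cast hn.one_lt)).ne'
    rw [vonMangoldt_apply_prime hn, mul_div_mul_right _ _ this]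
  -- On primes, 1 + χ(p) is 2, 0 or 1 according as p ≡ 1 mod 4, p ≡ 3 mod 4 or p = 2.
  have hsum : ∑ n ∈ Ico 2 N with n.Prime, (1 + chi n) * Λ n / (n * Real.log n)
      = 2 * ∑ p ∈ range N with p.Prime ∧ p % 4 = 1, 1 / (p : ℝ)
        + ∑ p ∈ range N with p.Prime ∧ p = 2, 1 / (p : ℝ) := by
    have : (Ico 2 N).filter Nat.Prime = (range N).filter Nat.Prime := by
      ext n
      simp only [mem_filter, mem_Ico, mem_range]
      exact ⟨fun h => ⟨h.1.2, h.2⟩, fun h => ⟨⟨h.2.two_le, h.1⟩, h.2⟩⟩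
    rw [this, ← filter_filter, ← filter_filter, sum_filter (s := (range N).filter Nat.Prime),
      sum_filter (s := (range N).filter Nat.Prime), mul_sum, ← sum_add_distrib]
    refine sum_congr rfl fun p hpm => ?_
    have hpp := (mem_filter.1 hpm).2
    rw [hp p hpp, chi_eq]
    rcases hpp.eq_two_or_odd with rfl | hodd
    · norm_num
    · have h2 : p ≠ 2 := by rintro rfl; simp at hodd
      have : p % 4 = 1 ∨ p % 4 = 3 := by omega
      rcases this with h | h
      · simp [h, h2, hodd]; ring
      · simp [h, h2, hodd]
  have htwo : ∑ p ∈ range N with p.Prime ∧ p = 2, 1 / (p : ℝ) ≤ 1 := by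
    calc _ ≤ ∑ p ∈ {2}, 1 / ((p : ℕ) : ℝ) := by
          refine sum_le_sum_of_subset_of_nonneg (fun p hp => ?_) fun _ _ _ => by positivity
          simpa using (mem_filter.1 hp).2.2
      _ ≤ 1 := by norm_num
  have htwo0 : 0 ≤ ∑ p ∈ range N with p.Prime ∧ p = 2, 1 / (p : ℝ) :=
    sum_nonneg fun _ _ => by positivity
  have h := abs_le.1 (h₁ N hN)
  rw [← sum_filter_add_sum_filter_not (Ico 2 N) Nat.Prime, hsum] at h
  have := h.1
  have := h.2
  rw [abs_le]
  constructor <;> linarith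

theorem exists_abs_sum_prime_one_mod_four_sub_le :
    ∃ C : ℝ, ∀ t : ℕ,
      |∑ p ∈ range (2 ^ 2 ^ t) with p.Prime ∧ p % 4 = 1, 1 / (p : ℝ) - t * Real.log 2 / 2| ≤ C := by
  obtain ⟨C, h⟩ := exists_abs_sum_prime_one_mod_four_sub_log_log_le
  refine ⟨C + |Real.log (Real.log 2)|, fun t => ?_⟩
  have hl2 : 0 < Real.log 2 := Real.log_pos one_lt_two
  have h1 := h (2 ^ 2 ^ t) (by
    calc 2 = 2 ^ 1 := by norm_num
      _ ≤ 2 ^ 2 ^ t := Nat.pow_le_pow_right two_pos Nat.one_le_two_pow)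
  have e : Real.log (Real.log ((2 ^ 2 ^ t : ℕ) : ℝ)) = t * Real.log 2 + Real.log (Real.log 2) := by
    push_cast
    rw [Real.log_pow, Real.log_mul (by positivity) hl2.ne']
    push_cast
    rw [Real.log_pow]
  rw [e] at h1
  have h2 := le_abs_self (Real.log (Real.log 2))
  have h3 := neg_abs_le (Real.log (Real.log 2))
  have := abs_le.1 h1
  rw [abs_le]
  constructor <;> linarith [this.1, this.2]

end MertensPrimes

/-! ### The Brun-Hooley sieve for weights in the unit interval. -/

section BrunHooley

open Finset

variable {ι α : Type*}

/-- The `k`-th elementary symmetric sum of the values of `u` on `P`. -/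
def elemSum (u : ι → ℝ) (P : Finset ι) (k : ℕ) : ℝ :=
  ∑ S ∈ P.powersetCard k, ∏ p ∈ S, u p

/-- The truncated inclusion-exclusion sum with terms of order less than `b`. -/
def truncSum (u : ι → ℝ) (P : Finset ι) (b : ℕ) : ℝ :=
  ∑ k ∈ range b, (-1) ^ k * elemSum u P k

theorem elemSum_zero (u : ι → ℝ) (P : Finset ι) : elemSum u P 0 = 1 := by
  simp [elemSum]

theorem elemSum_empty_succ (u : ι → ℝ) (k : ℕ) : elemSum u ∅ (k + 1) = 0 := by
  rw [elemSum, powersetCard_eq_empty.2 (by simp), sum_empty]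

theorem elemSum_insert_succ [DecidableEq ι] (u : ι → ℝ) {P : Finset ι} {a : ι} (ha : a ∉ P) (k : ℕ) :
    elemSum u (insert a P) (k + 1) = elemSum u P (k + 1) + u a * elemSum u P k := by
  unfold elemSum
  rw [powersetCard_succ_insert ha, sum_union, sum_image, mul_sum]
  · congr 1
    refine sum_congr rfl fun S hS => ?_
    rw [prod_insert fun h => ha ((mem_powersetCard.1 hS).1 h)]
  · intro S hS T hT h
    have hS' : a ∉ S := fun h => ha ((mem_powersetCard.1 hS).1 h)
    have hT' : a ∉ T := fun h => ha ((mem_powersetCard.1 hT).1 h)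
    rw [← erase_insert hS', ← erase_insert hT', h]
  · rw [disjoint_left]
    intro S hS hS'
    obtain ⟨T, -, rfl⟩ := mem_image.1 hS'
    exact ha ((mem_powersetCard.1 hS).1 (mem_insert_self a T))

theorem elemSum_nonneg {u : ι → ℝ} {P : Finset ι} (hu : ∀ p ∈ P, 0 ≤ u p) (k : ℕ) :
    0 ≤ elemSum u P k :=
  sum_nonneg fun _ hS => prod_nonneg fun p hp => hu p ((mem_powersetCard.1 hS).1 hp)

theorem truncSum_insert_succ [DecidableEq ι] (u : ι → ℝ) {P : Finset ι} {a : ι} (ha : a ∉ P) (b : ℕ) :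
    truncSum u (insert a P) (b + 1) = truncSum u P (b + 1) - u a * truncSum u P b := by
  unfold truncSum
  rw [sum_range_succ', sum_range_succ', elemSum_zero, elemSum_zero, mul_sum, add_sub_right_comm,
    ← sum_sub_distrib]
  congr 1
  refine sum_congr rfl fun k _ => ?_
  rw [elemSum_insert_succ u ha]
  ring

/-- The Bonferroni inequalities for weights in the unit interval. -/
theorem bonferroni {u : ι → ℝ} {P : Finset ι} (h0 : ∀ p ∈ P, 0 ≤ u p) (h1 : ∀ p ∈ P, u p ≤ 1)
    (b : ℕ) :
    0 ≤ (-1) ^ b * (∏ p ∈ P, (1 - u p) - truncSum u P b) ∧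
      (-1) ^ b * (∏ p ∈ P, (1 - u p) - truncSum u P b) ≤ elemSum u P b := by
  classical
  induction P using Finset.induction_on generalizing b with
  | empty =>
    cases b with
    | zero => simp [truncSum, elemSum_zero]
    | succ b =>
      have : truncSum u ∅ (b + 1) = 1 := by
        rw [truncSum, sum_range_succ', elemSum_zero]
        simp [elemSum_empty_succ]
      simp [this, elemSum_empty_succ]
  | insert a P ha ih =>
    have ih' := fun b => ih (fun p hp => h0 p (mem_insert_of_mem hp))
      (fun p hp => h1 p (mem_insert_of_mem hp)) b
    have ha0 := h0 a (mem_insert_self a P)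
    cases b with
    | zero =>
      have h0' : ∀ p ∈ insert a P, 0 ≤ 1 - u p := fun p hp => sub_nonneg.2 (h1 p hp)
      have h1' : ∀ p ∈ insert a P, 1 - u p ≤ 1 := fun p hp => by linarith [h0 p hp]
      simpa [truncSum, elemSum_zero] using ⟨prod_nonneg h0', prod_le_one h0' h1'⟩
    | succ b =>
      have e : (-1) ^ (b + 1) * (∏ p ∈ insert a P, (1 - u p) - truncSum u (insert a P) (b + 1))
          = (-1) ^ (b + 1) * (∏ p ∈ P, (1 - u p) - truncSum u P (b + 1))
            + u a * ((-1) ^ b * (∏ p ∈ P, (1 - u p) - truncSum u P b)) := by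
        rw [truncSum_insert_succ u ha, prod_insert ha]; ring
      rw [e, elemSum_insert_succ u ha]
      exact ⟨add_nonneg (ih' _).1 (mul_nonneg ha0 (ih' _).1),
        add_le_add (ih' _).2 (mul_le_mul_of_nonneg_left (ih' _).2 ha0)⟩

theorem elemSum_le_pow_div_factorial {u : ι → ℝ} {P : Finset ι} (h0 : ∀ p ∈ P, 0 ≤ u p) (k : ℕ) :
    elemSum u P k ≤ (∑ p ∈ P, u p) ^ k / k.factorial := by
  classical
  induction P using Finset.induction_on generalizing k with
  | empty =>
    cases k with
    | zero => simp [elemSum_zero]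
    | succ k => simp [elemSum_empty_succ]
  | insert a P ha ih =>
    have ih' := fun b => ih (fun p hp => h0 p (mem_insert_of_mem hp)) b
    have ha0 := h0 a (mem_insert_self a P)
    have hs : 0 ≤ ∑ p ∈ P, u p := sum_nonneg fun p hp => h0 p (mem_insert_of_mem hp)
    cases k with
    | zero => simp [elemSum_zero]
    | succ k =>
      rw [elemSum_insert_succ u ha, sum_insert ha]
      refine (add_le_add (ih' _) (mul_le_mul_of_nonneg_left (ih' _) ha0)).trans ?_
      set L := ∑ p ∈ P, u p
      have hpow : L ^ (k + 1) + (k + 1) * u a * L ^ k ≤ (u a + L) ^ (k + 1) := by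
        clear ih ih'
        induction k with
        | zero => simp; linarith
        | succ k ih =>
          have := mul_le_mul_of_nonneg_right ih (add_nonneg ha0 hs)
          rw [pow_succ (u a + L)]
          refine le_trans ?_ this
          have h3 : 0 ≤ (k + 1) * (u a * u a) * L ^ k := by positivity
          push_cast
          ring_nf at h3 ⊢
          linarith
      rw [Nat.factorial_succ, Nat.cast_mul]
      have hk : (0 : ℝ) < k.factorial := by positivity
      have hk1 : (0 : ℝ) < ((k + 1 : ℕ) : ℝ) := by positivity
      rw [div_add' _ _ _ (by positivity), div_le_div_iff_of_pos_right (by positivity)]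
      refine le_trans (le_of_eq ?_) hpow
      push_cast
      field_simp

/-- Bounds the sieve remainder of one layer: with `u` constantly `r`, the left side adds up r^|S|
over all S of size at most `b`. -/
theorem sum_elemSum_le_pow {u : ι → ℝ} {P : Finset ι} (h0 : ∀ p ∈ P, 0 ≤ u p) (b : ℕ) :
    ∑ k ∈ range (b + 1), elemSum u P k ≤ (1 + ∑ p ∈ P, u p) ^ b := by
  have hs : 0 ≤ ∑ p ∈ P, u p := sum_nonneg h0
  induction b with
  | zero => simp [elemSum_zero]
  | succ b ih =>
    rw [sum_range_succ, pow_succ, mul_add, mul_one]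
    refine add_le_add ih ?_
    refine (elemSum_le_pow_div_factorial h0 _).trans ?_
    refine (div_le_self (by positivity) (Nat.one_le_cast.2 (Nat.factorial_pos _))).trans ?_
    rw [pow_succ]
    gcongr
    linarith

/-- Expanding the product over layers gives sums over unions of sets S, to which `hrep` applies. The
set `T` carries the elements already chosen through the induction on `J`. Arbitrary coefficients of
size at most 1 let one statement serve both the truncated product and its variants with one factor
replaced by an error term. -/
theorem abs_sum_prod_elemSum_sub_le [DecidableEq ι] (A : Finset α) (u : α → ι → ℝ) (w : ι → ℝ) (X r : ℝ)
    (U : Finset ι)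
    (hrep : ∀ S ⊆ U, |∑ n ∈ A, ∏ p ∈ S, u n p - X * ∏ p ∈ S, w p| ≤ r ^ #S)
    (P : ℕ → Finset ι) (b : ℕ → ℕ) (c : ℕ → ℕ → ℝ) (hc : ∀ j k, |c j k| ≤ 1)
    (J : Finset ℕ) (hPU : ∀ j ∈ J, P j ⊆ U)
    (hdisj : ∀ i ∈ J, ∀ j ∈ J, i ≠ j → Disjoint (P i) (P j)) :
    ∀ T ⊆ U, (∀ j ∈ J, Disjoint (P j) T) →
      |∑ n ∈ A, (∏ j ∈ J, ∑ k ∈ range (b j), c j k * elemSum (u n) (P j) k) * ∏ p ∈ T, u n p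
        - X * (∏ j ∈ J, ∑ k ∈ range (b j), c j k * elemSum w (P j) k) * ∏ p ∈ T, w p|
        ≤ (∏ j ∈ J, ∑ k ∈ range (b j), elemSum (fun _ => r) (P j) k) * r ^ #T := by
  induction J using Finset.induction_on with
  | empty =>
    intro T hT _
    simpa using hrep T hT
  | insert a J ha ih =>
    have ih' := ih (fun j hj => hPU j (mem_insert_of_mem hj))
      (fun i hi j hj => hdisj i (mem_insert_of_mem hi) j (mem_insert_of_mem hj))
    intro T hT hTd
    have hunion : ∀ v : ι → ℝ, ∀ k, ∀ y : ℝ,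
        elemSum v (P a) k * y * ∏ p ∈ T, v p
          = ∑ S ∈ (P a).powersetCard k, y * ∏ p ∈ S ∪ T, v p := by
      intro v k y
      rw [elemSum, sum_mul, sum_mul]
      refine sum_congr rfl fun S hS => ?_
      rw [prod_union (disjoint_of_subset_left (mem_powersetCard.1 hS).1
        (hTd a (mem_insert_self a J)))]
      ring
    have e : ∑ n ∈ A, (∏ j ∈ insert a J, ∑ k ∈ range (b j), c j k * elemSum (u n) (P j) k)
          * ∏ p ∈ T, u n p
        - X * (∏ j ∈ insert a J, ∑ k ∈ range (b j), c j k * elemSum w (P j) k) * ∏ p ∈ T, w p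
        = ∑ k ∈ range (b a), c a k * ∑ S ∈ (P a).powersetCard k,
          (∑ n ∈ A, (∏ j ∈ J, ∑ k ∈ range (b j), c j k * elemSum (u n) (P j) k)
              * ∏ p ∈ S ∪ T, u n p
            - X * (∏ j ∈ J, ∑ k ∈ range (b j), c j k * elemSum w (P j) k)
              * ∏ p ∈ S ∪ T, w p) := by
      simp only [prod_insert ha, sum_sub_distrib, mul_sub]
      congr 1
      · have e1 : ∀ n, (∑ k ∈ range (b a), c a k * elemSum (u n) (P a) k)
              * (∏ j ∈ J, ∑ k ∈ range (b j), c j k * elemSum (u n) (P j) k) * ∏ p ∈ T, u n p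
            = ∑ k ∈ range (b a), c a k * ∑ S ∈ (P a).powersetCard k,
              (∏ j ∈ J, ∑ k ∈ range (b j), c j k * elemSum (u n) (P j) k)
                * ∏ p ∈ S ∪ T, u n p := by
          intro n
          rw [sum_mul, sum_mul]
          refine sum_congr rfl fun k _ => ?_
          rw [← hunion]
          ring
        rw [sum_congr rfl fun n _ => e1 n, sum_comm]
        refine sum_congr rfl fun k _ => ?_
        rw [← mul_sum, sum_comm]
      · rw [sum_mul, mul_sum, sum_mul]
        refine sum_congr rfl fun k _ => ?_
        rw [← hunion]
        ring
    rw [e, prod_insert ha, sum_mul, sum_mul]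
    refine (abs_sum_le_sum_abs _ _).trans (sum_le_sum fun k _ => ?_)
    rw [abs_mul]
    refine (mul_le_of_le_one_left (abs_nonneg _) (hc a k)).trans ?_
    refine (abs_sum_le_sum_abs _ _).trans ?_
    rw [elemSum, sum_mul, sum_mul]
    refine sum_le_sum fun S hS => ?_
    have hSP := (mem_powersetCard.1 hS).1
    have hST : Disjoint S T := disjoint_of_subset_left hSP (hTd a (mem_insert_self a J))
    refine (ih' (S ∪ T) (union_subset (hSP.trans (hPU a (mem_insert_self a J))) hT)
      fun j hj => ?_).trans (le_of_eq ?_)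
    · rw [disjoint_union_right]
      refine ⟨disjoint_of_subset_right hSP (hdisj j (mem_insert_of_mem hj) a
        (mem_insert_self a J) ?_), hTd j (mem_insert_of_mem hj)⟩
      rintro rfl
      exact ha hj
    · rw [card_union_of_disjoint hST, pow_add, prod_const]
      ring

/-- Hooley's device for lower bounds: a product of lower bounds could have negative factors, so ∏ x
is bounded below by ∏ y minus corrections that replace one factor at a time by its error. -/
theorem prod_sub_sum_prod_ite_le {κ : Type*} [DecidableEq κ] {J : Finset κ} {x y e : κ → ℝ}
    (hx : ∀ j ∈ J, 0 ≤ x j) (hxy : ∀ j ∈ J, x j ≤ y j) (he : ∀ j ∈ J, y j - x j ≤ e j) :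
    ∏ j ∈ J, y j - ∑ l ∈ J, ∏ j ∈ J, (if j = l then e j else y j) ≤ ∏ j ∈ J, x j := by
  induction J using Finset.induction_on with
  | empty => simp
  | insert a J ha ih =>
    have ih' := ih (fun j hj => hx j (mem_insert_of_mem hj))
      (fun j hj => hxy j (mem_insert_of_mem hj)) (fun j hj => he j (mem_insert_of_mem hj))
    have hne : ∀ j ∈ J, j ≠ a := fun j hj h => ha (h ▸ hj)
    have e1 : ∏ j ∈ insert a J, (if j = a then e j else y j) = e a * ∏ j ∈ J, y j := by
      rw [prod_insert ha, if_pos rfl]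
      congr 1
      exact prod_congr rfl fun j hj => if_neg (hne j hj)
    have e2 : ∑ l ∈ J, ∏ j ∈ insert a J, (if j = l then e j else y j)
        = y a * ∑ l ∈ J, ∏ j ∈ J, (if j = l then e j else y j) := by
      rw [mul_sum]
      refine sum_congr rfl fun l hl => ?_
      rw [prod_insert ha, if_neg (hne l hl).symm]
    rw [sum_insert ha, e1, e2, prod_insert ha, prod_insert ha]
    have hxa := hx a (mem_insert_self a J)
    have hxya := hxy a (mem_insert_self a J)
    have hea := he a (mem_insert_self a J)
    have hY : ∏ j ∈ J, x j ≤ ∏ j ∈ J, y j :=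
      prod_le_prod (fun j hj => hx j (mem_insert_of_mem hj))
        fun j hj => hxy j (mem_insert_of_mem hj)
    have hX : 0 ≤ ∏ j ∈ J, x j := prod_nonneg fun j hj => hx j (mem_insert_of_mem hj)
    set D := ∑ l ∈ J, ∏ j ∈ J, (if j = l then e j else y j)
    have h1 := mul_le_mul_of_nonneg_right hea (hX.trans hY)
    have h2 := mul_le_mul_of_nonneg_right hxya (sub_nonneg.2 hY)
    have h3 := mul_le_mul_of_nonneg_left (show ∏ j ∈ J, y j - ∏ j ∈ J, x j ≤ D by linarith)
      (hxa.trans hxya)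
    nlinarith

/-- The Brun-Hooley sieve. -/
theorem brunHooley [DecidableEq ι] (A : Finset α) (u : α → ι → ℝ) (w : ι → ℝ) {X : ℝ} (hX : 0 ≤ X) (r : ℝ)
    (U : Finset ι)
    (hrep : ∀ S ⊆ U, |∑ n ∈ A, ∏ p ∈ S, u n p - X * ∏ p ∈ S, w p| ≤ r ^ #S)
    (hu0 : ∀ n, ∀ p ∈ U, 0 ≤ u n p) (hu1 : ∀ n, ∀ p ∈ U, u n p ≤ 1)
    (hw0 : ∀ p ∈ U, 0 ≤ w p) (hw1 : ∀ p ∈ U, w p < 1)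
    (P : ℕ → Finset ι) (b : ℕ → ℕ) (hb : ∀ j, Odd (b j))
    (J : Finset ℕ) (hPU : ∀ j ∈ J, P j ⊆ U)
    (hdisj : ∀ i ∈ J, ∀ j ∈ J, i ≠ j → Disjoint (P i) (P j))
    (hsmall : ∑ j ∈ J, elemSum w (P j) (b j) / ∏ p ∈ P j, (1 - w p) ≤ 1 / 2) :
    X * (∏ j ∈ J, ∏ p ∈ P j, (1 - w p)) / 2
        - (#J + 1) * ∏ j ∈ J, ∑ k ∈ range (b j + 1), elemSum (fun _ => r) (P j) k
      ≤ ∑ n ∈ A, ∏ j ∈ J, ∏ p ∈ P j, (1 - u n p) ∧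
    ∑ n ∈ A, ∏ j ∈ J, ∏ p ∈ P j, (1 - u n p)
      ≤ 2 * X * (∏ j ∈ J, ∏ p ∈ P j, (1 - w p))
        + ∏ j ∈ J, ∑ k ∈ range (b j + 1), elemSum (fun _ => r) (P j) k := by
  set B := ∏ j ∈ J, ∑ k ∈ range (b j + 1), elemSum (fun _ => r) (P j) k with hB
  set V : ℕ → ℝ := fun j => ∏ p ∈ P j, (1 - w p) with hV
  set E : ℕ → ℝ := fun j => elemSum w (P j) (b j) with hE
  set Y : ℕ → ℝ := fun j => truncSum w (P j) (b j) with hY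
  have hVpos : ∀ j ∈ J, 0 < V j := fun j hj =>
    prod_pos fun p hp => sub_pos.2 (hw1 p (hPU j hj hp))
  have hEnn : ∀ j ∈ J, 0 ≤ E j := fun j hj => elemSum_nonneg (fun p hp => hw0 p (hPU j hj hp)) _
  have odd_neg : ∀ j, (-1 : ℝ) ^ b j = -1 := fun j => (hb j).neg_one_pow
  have hbon : ∀ v : ι → ℝ, (∀ p ∈ U, 0 ≤ v p) → (∀ p ∈ U, v p ≤ 1) → ∀ j ∈ J,
      ∏ p ∈ P j, (1 - v p) ≤ truncSum v (P j) (b j) ∧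
      truncSum v (P j) (b j) - ∏ p ∈ P j, (1 - v p) ≤ elemSum v (P j) (b j) := by
    intro v h0 h1 j hj
    have h := bonferroni (u := v) (P := P j) (fun p hp => h0 p (hPU j hj hp))
      (fun p hp => h1 p (hPU j hj hp)) (b j)
    rw [odd_neg] at h
    constructor <;> linarith [h.1, h.2]
  have hVY : ∀ j ∈ J, V j ≤ Y j := fun j hj => (hbon w hw0 (fun p hp => (hw1 p hp).le) j hj).1
  have hYE : ∀ j ∈ J, Y j ≤ V j + E j := fun j hj => by
    linarith [(hbon w hw0 (fun p hp => (hw1 p hp).le) j hj).2]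
  -- Both the truncated sum and the first omitted term are written over `range (b j + 1)`, so that
  -- the same remainder `B` bounds every expansion.
  have hcoef1 : ∀ v : ι → ℝ, ∀ j, ∑ k ∈ range (b j + 1),
      (if k = b j then 0 else (-1) ^ k) * elemSum v (P j) k = truncSum v (P j) (b j) := by
    intro v j
    rw [sum_range_succ, if_pos rfl, zero_mul, add_zero, truncSum]
    exact sum_congr rfl fun k hk => by rw [if_neg (mem_range.1 hk).ne]
  have hcoef2 : ∀ v : ι → ℝ, ∀ j, ∑ k ∈ range (b j + 1),
      (if k = b j then 1 else 0) * elemSum v (P j) k = elemSum v (P j) (b j) := by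
    intro v j
    rw [sum_eq_single (b j)]
    · simp
    · intro k _ h; simp [h]
    · intro h; exact absurd (self_mem_range_succ _) h
  have hmain : |∑ n ∈ A, ∏ j ∈ J, truncSum (u n) (P j) (b j) - X * ∏ j ∈ J, Y j| ≤ B := by
    have h := abs_sum_prod_elemSum_sub_le A u w X r U hrep P (fun j => b j + 1)
      (fun j k => if k = b j then 0 else (-1) ^ k)
      (fun j k => by split_ifs <;> simp) J hPU hdisj ∅ (empty_subset _) (by simp)
    simp only [hcoef1, prod_empty, mul_one, card_empty, pow_zero] at h
    exact h
  have herr : ∀ l, |∑ n ∈ A, ∏ j ∈ J, (if j = l then elemSum (u n) (P j) (b j)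
        else truncSum (u n) (P j) (b j)) - X * ∏ j ∈ J, (if j = l then E j else Y j)| ≤ B := by
    intro l
    have h := abs_sum_prod_elemSum_sub_le A u w X r U hrep P (fun j => b j + 1)
      (fun j k => if j = l then (if k = b j then 1 else 0) else if k = b j then 0 else (-1) ^ k)
      (fun j k => by split_ifs <;> simp) J hPU hdisj ∅ (empty_subset _) (by simp)
    have hsplit : ∀ v : ι → ℝ, ∀ j, ∑ k ∈ range (b j + 1),
        (if j = l then (if k = b j then (1 : ℝ) else 0) else if k = b j then 0 else (-1) ^ k)
          * elemSum v (P j) k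
        = if j = l then elemSum v (P j) (b j) else truncSum v (P j) (b j) := by
      intro v j
      split_ifs with hj
      · exact hcoef2 v j
      · exact hcoef1 v j
    simp only [hsplit, prod_empty, mul_one, card_empty, pow_zero] at h
    exact h
  have hVprod : 0 < ∏ j ∈ J, V j := prod_pos hVpos
  constructor
  · have hlow : ∑ n ∈ A, ∏ j ∈ J, truncSum (u n) (P j) (b j)
          - ∑ l ∈ J, ∑ n ∈ A, ∏ j ∈ J, (if j = l then elemSum (u n) (P j) (b j)
            else truncSum (u n) (P j) (b j))
        ≤ ∑ n ∈ A, ∏ j ∈ J, ∏ p ∈ P j, (1 - u n p) := by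
      rw [sum_comm (s := J), ← sum_sub_distrib]
      refine sum_le_sum fun n _ => ?_
      exact prod_sub_sum_prod_ite_le
        (fun j hj => prod_nonneg fun p hp => sub_nonneg.2 (hu1 n p (hPU j hj hp)))
        (fun j hj => (hbon (u n) (hu0 n) (hu1 n) j hj).1)
        (fun j hj => (hbon (u n) (hu0 n) (hu1 n) j hj).2)
    have hsumerr : ∑ l ∈ J, ∑ n ∈ A, ∏ j ∈ J, (if j = l then elemSum (u n) (P j) (b j)
            else truncSum (u n) (P j) (b j))
        ≤ X * ((∏ j ∈ J, Y j) / 2) + #J * B := by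
      have hone : ∀ l ∈ J, ∏ j ∈ J, (if j = l then E j else Y j)
          ≤ (∏ j ∈ J, Y j) * (E l / V l) := by
        intro l hl
        rw [← mul_prod_erase J _ hl, ← mul_prod_erase J Y hl, if_pos rfl]
        rw [prod_congr rfl fun j hj => if_neg (ne_of_mem_erase hj)]
        have h1 : E l ≤ Y l * (E l / V l) := by
          rw [mul_div_assoc', le_div_iff₀ (hVpos l hl), mul_comm]
          exact mul_le_mul_of_nonneg_right (hVY l hl) (hEnn l hl)
        have h2 : 0 ≤ ∏ j ∈ J.erase l, Y j := prod_nonneg fun j hj =>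
          (hVpos j (mem_of_mem_erase hj)).le.trans (hVY j (mem_of_mem_erase hj))
        calc E l * ∏ j ∈ J.erase l, Y j ≤ Y l * (E l / V l) * ∏ j ∈ J.erase l, Y j :=
              mul_le_mul_of_nonneg_right h1 h2
          _ = _ := by ring
      calc _ ≤ ∑ l ∈ J, (X * ((∏ j ∈ J, Y j) * (E l / V l)) + B) := by
            refine sum_le_sum fun l hl => ?_
            have h1 := (abs_le.1 (herr l)).2
            have h2 := mul_le_mul_of_nonneg_left (hone l hl) hX
            linarith
        _ = X * ((∏ j ∈ J, Y j) * ∑ l ∈ J, E l / V l) + #J * B := by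
            rw [sum_add_distrib, ← mul_sum, ← mul_sum, sum_const, nsmul_eq_mul]
        _ ≤ _ := by
            have hY0 : 0 ≤ ∏ j ∈ J, Y j :=
              prod_nonneg fun j hj => (hVpos j hj).le.trans (hVY j hj)
            have := mul_le_mul_of_nonneg_left (mul_le_mul_of_nonneg_left hsmall hY0) hX
            linarith
    have h1 := (abs_le.1 hmain).1
    have h2 : ∏ j ∈ J, V j ≤ ∏ j ∈ J, Y j := prod_le_prod (fun j hj => (hVpos j hj).le) hVY
    have h3 := mul_le_mul_of_nonneg_left h2 hX
    linarith
  · have hup : ∑ n ∈ A, ∏ j ∈ J, ∏ p ∈ P j, (1 - u n p)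
        ≤ ∑ n ∈ A, ∏ j ∈ J, truncSum (u n) (P j) (b j) :=
      sum_le_sum fun n _ => prod_le_prod
        (fun j hj => prod_nonneg fun p hp => sub_nonneg.2 (hu1 n p (hPU j hj hp)))
        (fun j hj => (hbon (u n) (hu0 n) (hu1 n) j hj).1)
    have h1 := (abs_le.1 hmain).2
    have h2 : ∏ j ∈ J, Y j ≤ (∏ j ∈ J, V j) * 2 := by
      -- V + E ≤ V exp(E/V) turns the product of relative errors into the exponential of their sum,
      -- and exp(1/2) ≤ 2.
      calc ∏ j ∈ J, Y j ≤ ∏ j ∈ J, (V j * Real.exp (E j / V j)) := by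
            refine prod_le_prod (fun j hj => (hVpos j hj).le.trans (hVY j hj)) fun j hj => ?_
            refine (hYE j hj).trans ?_
            have := mul_le_mul_of_nonneg_left (Real.add_one_le_exp (E j / V j)) (hVpos j hj).le
            rw [mul_add, mul_div_cancel₀ _ (hVpos j hj).ne'] at this
            linarith
        _ = (∏ j ∈ J, V j) * Real.exp (∑ j ∈ J, E j / V j) := by
            rw [prod_mul_distrib, Real.exp_sum]
        _ ≤ (∏ j ∈ J, V j) * 2 := by
            refine mul_le_mul_of_nonneg_left ?_ hVprod.le
            refine (Real.exp_le_exp.2 hsmall).trans ?_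
            have h4 : Real.exp (1 / 2) * Real.exp (1 / 2) = Real.exp 1 := by
              rw [← Real.exp_add]; norm_num
            have := Real.exp_one_lt_d9
            nlinarith [Real.exp_pos (1 / 2 : ℝ)]
    have h3 := mul_le_mul_of_nonneg_left h2 hX
    linarith

end BrunHooley

/-! ### Roots of a^2 + 1 modulo prime powers and the level of distribution. -/

section LocalDensity

open Finset

/-- The residues `a` modulo `q` with `a ^ 2 + 1 ≡ 0`. -/
def rootsMod (q : ℕ) : Finset ℕ := {a ∈ range q | q ∣ a ^ 2 + 1}

theorem dvd_sq_add_one_congr {q m n : ℕ} (h : m ≡ n [MOD q]) :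
    q ∣ m ^ 2 + 1 ↔ q ∣ n ^ 2 + 1 :=
  ((h.pow 2).add_right 1).dvd_iff dvd_rfl

theorem ite_dvd_sq_add_one {q : ℕ} (hq : 0 < q) (n : ℕ) :
    (if q ∣ n ^ 2 + 1 then (1 : ℝ) else 0) = ∑ a ∈ rootsMod q, if n ≡ a [MOD q] then 1 else 0 := by
  have h0 : n ≡ n % q [MOD q] := (Nat.mod_modEq n q).symm
  have huniq : ∀ a ∈ rootsMod q, n ≡ a [MOD q] → a = n % q := fun a ha h => by
    have := mem_range.1 (mem_filter.1 ha).1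
    rw [h, Nat.mod_eq_of_lt this]
  split_ifs with h
  · rw [sum_eq_single (n % q), if_pos h0]
    · intro a ha hne
      exact if_neg fun h' => hne (huniq a ha h')
    · intro hn
      exact absurd (mem_filter.2 ⟨mem_range.2 (Nat.mod_lt _ hq), (dvd_sq_add_one_congr h0).1 h⟩) hn
  · symm
    refine sum_eq_zero fun a ha => if_neg fun h' => h ?_
    exact (dvd_sq_add_one_congr h').2 (mem_filter.1 ha).2

/-- Two roots satisfy p^e ∣ (b - a)(b + a), and p cannot divide both factors, as it would divide 2a.
Hence p^e divides one of them and b ≡ ±a. -/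
theorem card_rootsMod_prime_pow_le {p : ℕ} (hp : p.Prime) (h2 : p ≠ 2) (e : ℕ) (he : e ≠ 0) :
    #(rootsMod (p ^ e)) ≤ 2 := by
  rcases (rootsMod (p ^ e)).eq_empty_or_nonempty with h | ⟨a, ha⟩
  · simp [h]
  suffices rootsMod (p ^ e) ⊆ {a, p ^ e - a} from (card_le_card this).trans card_le_two
  intro b hb
  obtain ⟨ha1, ha2⟩ := mem_filter.1 ha
  obtain ⟨hb1, hb2⟩ := mem_filter.1 hb
  rw [mem_range] at ha1 hb1
  have hpZ : Prime (p : ℤ) := Nat.prime_iff_prime_int.1 hp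
  have hpe : p ∣ p ^ e := dvd_pow_self p he
  have hpa : ¬ p ∣ a := fun h => by
    have h1 : p ∣ a ^ 2 + 1 := hpe.trans ha2
    rw [Nat.dvd_add_right (dvd_pow h two_ne_zero)] at h1
    exact hp.one_lt.ne' (Nat.dvd_one.1 h1)
  have hdvd : (p : ℤ) ^ e ∣ ((b : ℤ) - a) * (b + a) := by
    have h1 : ((p ^ e : ℕ) : ℤ) ∣ ((b ^ 2 + 1 : ℕ) : ℤ) := Int.natCast_dvd_natCast.2 hb2
    have h3 : ((p ^ e : ℕ) : ℤ) ∣ ((a ^ 2 + 1 : ℕ) : ℤ) := Int.natCast_dvd_natCast.2 ha2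
    have h4 := dvd_sub h1 h3
    push_cast at h4
    convert! h4 using 1
    ring
  have hnot : ¬ ((p : ℤ) ∣ (b : ℤ) - a ∧ (p : ℤ) ∣ (b : ℤ) + a) := by
    rintro ⟨h1, h3⟩
    have h4 : (p : ℤ) ∣ 2 * a := by
      have := dvd_sub h3 h1
      convert! this using 1
      ring
    rcases hpZ.dvd_or_dvd h4 with h | h
    · have : p ∣ 2 := by exact_mod_cast h
      exact h2 ((Nat.prime_dvd_prime_iff_eq hp Nat.prime_two).1 this)
    · exact hpa (by exact_mod_cast h)
  have hcases : (p : ℤ) ^ e ∣ (b : ℤ) - a ∨ (p : ℤ) ^ e ∣ (b : ℤ) + a := by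
    by_cases h : (p : ℤ) ∣ (b : ℤ) - a
    · left
      exact (IsCoprime.pow_left ((hpZ.coprime_iff_not_dvd).2
        fun h' => hnot ⟨h, h'⟩)).dvd_of_dvd_mul_right hdvd
    · right
      exact (IsCoprime.pow_left ((hpZ.coprime_iff_not_dvd).2 h)).dvd_of_dvd_mul_left hdvd
  rw [mem_insert, mem_singleton]
  rcases hcases with h | h
  · left
    have h' : (b : ℤ) ≡ a [ZMOD ((p ^ e : ℕ) : ℤ)] := by
      refine (Int.modEq_iff_dvd.2 ?_).symm
      push_cast
      exact h
    exact Nat.ModEq.eq_of_lt_of_lt (Int.natCast_modEq_iff.1 h') hb1 ha1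
  · right
    have h' : p ^ e ∣ b + a := by exact_mod_cast h
    obtain ⟨c, hc⟩ := h'
    have ha0 : a ≠ 0 := by rintro rfl; exact hpa (dvd_zero p)
    have : c = 1 := by
      have h1 : c ≠ 0 := by rintro rfl; omega
      have h3 : c < 2 := by
        by_contra h4
        have : p ^ e * 2 ≤ p ^ e * c := Nat.mul_le_mul_left _ (by omega)
        omega
      omega
    rw [this] at hc
    omega

theorem card_rootsMod_two : #(rootsMod 2) = 1 := by decide

theorem card_rootsMod_four : #(rootsMod (2 ^ 2)) = 0 := by decide

theorem card_rootsMod_prime_le {p : ℕ} (hp : p.Prime) : #(rootsMod p) ≤ 2 := by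
  rcases eq_or_ne p 2 with rfl | h
  · rw [card_rootsMod_two]; norm_num
  · simpa using card_rootsMod_prime_pow_le hp h 1 one_ne_zero

theorem card_rootsMod_prime_sq_le {p : ℕ} (hp : p.Prime) : #(rootsMod (p ^ 2)) ≤ 2 := by
  rcases eq_or_ne p 2 with rfl | h
  · rw [card_rootsMod_four]; norm_num
  · exact card_rootsMod_prime_pow_le hp h 2 two_ne_zero

theorem rootsMod_eq_empty {p : ℕ} (hp : p.Prime) (h3 : p % 4 = 3) {e : ℕ} (he : e ≠ 0) :
    rootsMod (p ^ e) = ∅ := by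
  have := Fact.mk hp
  rw [rootsMod, filter_eq_empty_iff]
  intro a _ h
  have h1 : ((a ^ 2 + 1 : ℕ) : ZMod p) = 0 :=
    (ZMod.natCast_eq_zero_iff _ _).2 ((dvd_pow_self p he).trans h)
  push_cast at h1
  refine (ZMod.mod_four_ne_three_of_sq_eq_neg_one (y := (a : ZMod p)) ?_) h3
  exact eq_neg_of_add_eq_zero_left h1

theorem card_rootsMod_prime {p : ℕ} (hp : p.Prime) (h1 : p % 4 = 1) : #(rootsMod p) = 2 := by
  have := Fact.mk hp
  refine le_antisymm (card_rootsMod_prime_le hp) ?_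
  obtain ⟨y, hy⟩ := ZMod.exists_sq_eq_neg_one_iff.2 (show p % 4 ≠ 3 by omega)
  have hroot : ∀ y : ZMod p, -1 = y * y → y.val ∈ rootsMod p := by
    intro y hy
    refine mem_filter.2 ⟨mem_range.2 (ZMod.val_lt y), ?_⟩
    rw [← ZMod.natCast_eq_zero_iff]
    push_cast
    rw [ZMod.natCast_zmod_val, sq, ← hy]
    ring
  have hne : y.val ≠ (-y).val := by
    intro h
    have h' := ZMod.val_injective p h
    have hy0 : y = 0 := by
      have : (2 : ZMod p) ≠ 0 := by
        intro h2
        have : p ∣ 2 := (ZMod.natCast_eq_zero_iff 2 p).1 (by exact_mod_cast h2)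
        have := (Nat.prime_dvd_prime_iff_eq hp Nat.prime_two).1 this
        omega
      have h3 : (2 : ZMod p) * y = 0 := by
        rw [two_mul]
        nth_rewrite 2 [h']
        ring
      exact (mul_eq_zero.1 h3).resolve_left this
    rw [hy0] at hy
    simp at hy
  rw [← card_pair hne]
  refine card_le_card fun b hb => ?_
  rw [mem_insert, mem_singleton] at hb
  rcases hb with rfl | rfl
  · exact hroot y hy
  · exact hroot (-y) (by rw [hy]; ring)

/-- The deficit at `p` of a local factor which is `1`, `1 / 2` and `1 / 2 - θ` according to
whether `n ^ 2 + 1` is divisible by `p` and by `p ^ 2`. -/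
noncomputable def localWeight (θ : ℝ) (n p : ℕ) : ℝ :=
  1 / 2 * (if p ∣ n ^ 2 + 1 then 1 else 0) + θ * (if p ^ 2 ∣ n ^ 2 + 1 then 1 else 0)

/-- The mean value of `localWeight θ · p`. -/
noncomputable def localDensity (θ : ℝ) (p : ℕ) : ℝ :=
  1 / 2 * (#(rootsMod p) / p) + θ * (#(rootsMod (p ^ 2)) / (p ^ 2 : ℕ))

theorem localWeight_nonneg {θ : ℝ} (hθ : 0 ≤ θ) (n p : ℕ) : 0 ≤ localWeight θ n p := by
  unfold localWeight
  positivity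

theorem localWeight_le_one {θ : ℝ} (hθ' : θ ≤ 1 / 2) (n p : ℕ) :
    localWeight θ n p ≤ 1 := by
  unfold localWeight
  split_ifs <;> linarith

theorem localDensity_nonneg {θ : ℝ} (hθ : 0 ≤ θ) (p : ℕ) : 0 ≤ localDensity θ p := by
  unfold localDensity
  positivity

theorem localDensity_two (θ : ℝ) : localDensity θ 2 = 1 / 4 := by
  rw [localDensity, card_rootsMod_two, card_rootsMod_four]
  norm_num

theorem localDensity_of_mod_four_eq_three (θ : ℝ) {p : ℕ} (hp : p.Prime) (h3 : p % 4 = 3) :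
    localDensity θ p = 0 := by
  have h1 := rootsMod_eq_empty hp h3 one_ne_zero
  rw [pow_one] at h1
  rw [localDensity, h1, rootsMod_eq_empty hp h3 two_ne_zero]
  simp

theorem localDensity_of_mod_four_eq_one {θ : ℝ} (hθ : 0 ≤ θ) (hθ' : θ ≤ 1 / 2) {p : ℕ}
    (hp : p.Prime) (h1 : p % 4 = 1) :
    1 / (p : ℝ) ≤ localDensity θ p ∧ localDensity θ p ≤ 1 / p + 1 / (p : ℝ) ^ 2 := by
  rw [localDensity, card_rootsMod_prime hp h1]
  have hc : (#(rootsMod (p ^ 2)) : ℝ) ≤ 2 := by exact_mod_cast card_rootsMod_prime_sq_le hp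
  have hp0 : (0 : ℝ) < p := by exact_mod_cast hp.pos
  have e : (1 : ℝ) / 2 * ((2 : ℕ) / p) = 1 / p := by push_cast; ring
  rw [e]
  constructor
  · have : 0 ≤ θ * (#(rootsMod (p ^ 2)) / (p ^ 2 : ℕ) : ℝ) := by positivity
    linarith
  · have : θ * (#(rootsMod (p ^ 2)) / (p ^ 2 : ℕ) : ℝ) ≤ 1 / 2 * (2 / (p : ℝ) ^ 2) := by
      push_cast
      gcongr
    have e2 : (1 : ℝ) / 2 * (2 / (p : ℝ) ^ 2) = 1 / (p : ℝ) ^ 2 := by ring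
    linarith

theorem abs_card_modEq_sub_le (N a : ℕ) {q : ℕ} (hq : 0 < q) :
    |(∑ n ∈ Ioc 0 N, if n ≡ a [MOD q] then (1 : ℝ) else 0) - N / q| ≤ 1 := by
  rw [sum_boole]
  have h := Nat.Ioc_filter_modEq_card 0 N hq a
  have hq' : (0 : ℚ) < q := by exact_mod_cast hq
  have hmono : ⌊((0 : ℕ) - a : ℚ) / q⌋ ≤ ⌊((N : ℕ) - a : ℚ) / q⌋ := by
    apply Int.floor_le_floor
    gcongr
    simp
  rw [max_eq_left (sub_nonneg.2 hmono)] at h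
  have f1 := Int.floor_le (((0 : ℕ) - a : ℚ) / q)
  have f2 := Int.lt_floor_add_one (((0 : ℕ) - a : ℚ) / q)
  have f3 := Int.floor_le (((N : ℕ) - a : ℚ) / q)
  have f4 := Int.lt_floor_add_one (((N : ℕ) - a : ℚ) / q)
  have h' : (#{n ∈ Ioc 0 N | n ≡ a [MOD q]} : ℚ)
      = ⌊((N : ℕ) - a : ℚ) / q⌋ - ⌊((0 : ℕ) - a : ℚ) / q⌋ := by exact_mod_cast h
  have e : ((N : ℕ) - a : ℚ) / q - ((0 : ℕ) - a : ℚ) / q = N / q := by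
    push_cast
    ring
  have hQ : |(#{n ∈ Ioc 0 N | n ≡ a [MOD q]} : ℚ) - N / q| ≤ 1 := by
    rw [abs_le]
    constructor <;> linarith
  have hR := (Rat.cast_le (K := ℝ)).2 hQ
  push_cast at hR
  exact hR

/-- The primes already treated are absorbed in the congruence n ≡ a mod q. A new prime p splits it
by the Chinese remainder theorem into at most 2 classes with weight 1/2 and at most 2 classes with
weight θ ≤ 1/2, so the error at most doubles. -/
theorem abs_sum_prod_localWeight_sub_le {θ : ℝ} (hθ : 0 ≤ θ) (hθ' : θ ≤ 1 / 2) (N : ℕ)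
    (S : Finset ℕ) (hS : ∀ p ∈ S, p.Prime) :
    ∀ q : ℕ, 0 < q → (∀ p ∈ S, q.Coprime p) → ∀ a : ℕ,
      |∑ n ∈ Ioc 0 N, (if n ≡ a [MOD q] then (1 : ℝ) else 0) * ∏ p ∈ S, localWeight θ n p
        - N / q * ∏ p ∈ S, localDensity θ p| ≤ 2 ^ #S := by
  induction S using Finset.induction_on with
  | empty =>
    intro q hq _ a
    simpa using abs_card_modEq_sub_le N a hq
  | insert p S hp ih =>
    intro q hq hcop a
    have ih' := ih fun p hp => hS p (mem_insert_of_mem hp)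
    have hpp := hS p (mem_insert_self p S)
    have step : ∀ m : ℕ, 0 < m → q.Coprime m → (∀ p ∈ S, m.Coprime p) →
        |∑ n ∈ Ioc 0 N, (if n ≡ a [MOD q] then (1 : ℝ) else 0)
            * ((if m ∣ n ^ 2 + 1 then 1 else 0) * ∏ p ∈ S, localWeight θ n p)
          - N / q * (#(rootsMod m) / m * ∏ p ∈ S, localDensity θ p)|
          ≤ #(rootsMod m) * 2 ^ #S := by
      intro m hm hqm hmS
      have e : ∑ n ∈ Ioc 0 N, (if n ≡ a [MOD q] then (1 : ℝ) else 0)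
            * ((if m ∣ n ^ 2 + 1 then 1 else 0) * ∏ p ∈ S, localWeight θ n p)
          - N / q * (#(rootsMod m) / m * ∏ p ∈ S, localDensity θ p)
          = ∑ c ∈ rootsMod m, (∑ n ∈ Ioc 0 N,
            (if n ≡ Nat.chineseRemainder hqm a c [MOD q * m] then (1 : ℝ) else 0)
              * ∏ p ∈ S, localWeight θ n p - N / (q * m : ℕ) * ∏ p ∈ S, localDensity θ p) := by
        rw [sum_sub_distrib, sum_comm]
        congr 1
        · refine sum_congr rfl fun n _ => ?_
          rw [ite_dvd_sq_add_one hm, ← mul_assoc, ← sum_mul, mul_sum]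
          congr 1
          refine sum_congr rfl fun c _ => ?_
          have hk := (Nat.chineseRemainder hqm a c).2
          have hiff : n ≡ Nat.chineseRemainder hqm a c [MOD q * m]
              ↔ n ≡ a [MOD q] ∧ n ≡ c [MOD m] := by
            rw [← Nat.modEq_and_modEq_iff_modEq_mul hqm]
            exact ⟨fun h => ⟨h.1.trans hk.1, h.2.trans hk.2⟩,
              fun h => ⟨h.1.trans hk.1.symm, h.2.trans hk.2.symm⟩⟩
          simp only [hiff]
          by_cases h1 : n ≡ a [MOD q] <;> by_cases h2 : n ≡ c [MOD m] <;> simp [h1, h2]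
        · rw [sum_const, nsmul_eq_mul]
          push_cast
          ring
      rw [e]
      refine (abs_sum_le_sum_abs _ _).trans ?_
      rw [← nsmul_eq_mul, ← sum_const]
      refine sum_le_sum fun c _ => ?_
      exact ih' (q * m) (Nat.mul_pos hq hm) (fun p hp => Nat.Coprime.mul_left
        (hcop p (mem_insert_of_mem hp)) (hmS p hp)) _
    have hqp := hcop p (mem_insert_self p S)
    have hpS : ∀ r ∈ S, p.Coprime r := fun r hr =>
      (Nat.coprime_primes hpp (hS r (mem_insert_of_mem hr))).2 fun h => hp (h ▸ hr)
    have s1 := step p hpp.pos hqp hpS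
    have s2 := step (p ^ 2) (pow_pos hpp.pos 2) (hqp.pow_right 2)
      fun r hr => (hpS r hr).pow_left 2
    set A₁ := ∑ n ∈ Ioc 0 N, (if n ≡ a [MOD q] then (1 : ℝ) else 0)
            * ((if p ∣ n ^ 2 + 1 then 1 else 0) * ∏ p ∈ S, localWeight θ n p)
    set A₂ := ∑ n ∈ Ioc 0 N, (if n ≡ a [MOD q] then (1 : ℝ) else 0)
            * ((if p ^ 2 ∣ n ^ 2 + 1 then 1 else 0) * ∏ p ∈ S, localWeight θ n p)
    have e : ∑ n ∈ Ioc 0 N, (if n ≡ a [MOD q] then (1 : ℝ) else 0)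
          * ∏ p ∈ insert p S, localWeight θ n p
        - N / q * ∏ p ∈ insert p S, localDensity θ p
        = 1 / 2 * (A₁ - N / q * (#(rootsMod p) / p * ∏ p ∈ S, localDensity θ p))
          + θ * (A₂ - N / q * (#(rootsMod (p ^ 2)) / (p ^ 2 : ℕ)
            * ∏ p ∈ S, localDensity θ p)) := by
      have e1 : ∑ n ∈ Ioc 0 N, (if n ≡ a [MOD q] then (1 : ℝ) else 0)
          * ∏ p ∈ insert p S, localWeight θ n p = 1 / 2 * A₁ + θ * A₂ := by
        rw [mul_sum, mul_sum, ← sum_add_distrib]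
        refine sum_congr rfl fun n _ => ?_
        rw [prod_insert hp, localWeight]
        ring
      rw [e1, prod_insert hp, localDensity]
      ring
    rw [e, card_insert_of_notMem hp, pow_succ (2 : ℝ)]
    have c1 : (#(rootsMod p) : ℝ) ≤ 2 := by exact_mod_cast card_rootsMod_prime_le hpp
    have c2 : (#(rootsMod (p ^ 2)) : ℝ) ≤ 2 := by exact_mod_cast card_rootsMod_prime_sq_le hpp
    have h2S : (0 : ℝ) < 2 ^ #S := by positivity
    refine (abs_add_le _ _).trans ?_
    rw [abs_mul, abs_mul, abs_of_nonneg hθ, abs_of_pos (show (0 : ℝ) < 1 / 2 by norm_num)]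
    have b1 := s1.trans (mul_le_mul_of_nonneg_right c1 h2S.le)
    have b2 := s2.trans (mul_le_mul_of_nonneg_right c2 h2S.le)
    have b3 := mul_le_mul hθ' b2 (abs_nonneg _) (by norm_num)
    linarith

end LocalDensity

/-! ### Doubly exponential layers of primes and the choice of sieve parameters. -/

section Layers

open Finset

/-- The primes below `2 ^ 2 ^ t`. -/
def siftingPrimes (t : ℕ) : Finset ℕ := {p ∈ range (2 ^ 2 ^ t) | p.Prime}

/-- The primes in `[2 ^ 2 ^ i, 2 ^ 2 ^ (i + 1))`. -/
def primeLayer (i : ℕ) : Finset ℕ := {p ∈ Ico (2 ^ 2 ^ i) (2 ^ 2 ^ (i + 1)) | p.Prime}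

theorem two_pow_two_pow_le {i j : ℕ} (h : i ≤ j) : 2 ^ 2 ^ i ≤ 2 ^ 2 ^ j :=
  Nat.pow_le_pow_right two_pos (Nat.pow_le_pow_right two_pos h)

theorem siftingPrimes_succ (t : ℕ) :
    siftingPrimes (t + 1) = siftingPrimes t ∪ primeLayer t := by
  have := two_pow_two_pow_le (Nat.le_succ t)
  ext p
  simp only [siftingPrimes, primeLayer, mem_union, mem_filter, mem_range, mem_Ico]
  rw [Nat.succ_eq_add_one] at this
  constructor
  · rintro ⟨h1, h2⟩
    rcases lt_or_ge p (2 ^ 2 ^ t) with h | h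
    · exact Or.inl ⟨h, h2⟩
    · exact Or.inr ⟨⟨h, h1⟩, h2⟩
  · rintro (⟨h1, h2⟩ | ⟨⟨_, h1⟩, h2⟩)
    · exact ⟨h1.trans_le this, h2⟩
    · exact ⟨h1, h2⟩

theorem disjoint_siftingPrimes_primeLayer (t : ℕ) :
    Disjoint (siftingPrimes t) (primeLayer t) := by
  rw [disjoint_left]
  intro p hp hp'
  have h1 := mem_range.1 (mem_filter.1 hp).1
  have h2 := (mem_Ico.1 (mem_filter.1 hp').1).1
  omega

theorem siftingPrimes_zero : siftingPrimes 0 = ∅ := by decide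

theorem prod_primeLayer (f : ℕ → ℝ) (t : ℕ) :
    ∏ i ∈ range t, ∏ p ∈ primeLayer i, f p = ∏ p ∈ siftingPrimes t, f p := by
  induction t with
  | zero => simp [siftingPrimes_zero]
  | succ t ih =>
    rw [prod_range_succ, ih, siftingPrimes_succ, prod_union (disjoint_siftingPrimes_primeLayer t)]

theorem primeLayer_subset {i t : ℕ} (h : i < t) : primeLayer i ⊆ siftingPrimes t := by
  intro p hp
  obtain ⟨h1, h2⟩ := mem_filter.1 hp
  exact mem_filter.2 ⟨mem_range.2 ((mem_Ico.1 h1).2.trans_le (two_pow_two_pow_le h)), h2⟩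

theorem disjoint_primeLayer {i j : ℕ} (h : i ≠ j) : Disjoint (primeLayer i) (primeLayer j) := by
  wlog hij : i < j generalizing i j
  · exact (this h.symm (by omega)).symm
  exact disjoint_of_subset_left (primeLayer_subset hij) (disjoint_siftingPrimes_primeLayer j)

theorem exp_neg_le_one_sub {w : ℝ} (h1 : w ≤ 1 / 2) :
    Real.exp (-(w + 2 * w ^ 2)) ≤ 1 - w := by
  have hpos : 0 < 1 - w := by linarith
  rw [Real.exp_neg, inv_le_comm₀ (Real.exp_pos _) hpos]
  refine le_trans ?_ (Real.add_one_le_exp _)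
  rw [inv_le_iff_one_le_mul₀ hpos]
  nlinarith [mul_nonneg (sq_nonneg w) (show 0 ≤ 1 / 2 - w by linarith)]

theorem localDensity_le {θ : ℝ} (hθ : 0 ≤ θ) (hθ' : θ ≤ 1 / 2) {p : ℕ} (hp : p.Prime) :
    localDensity θ p ≤ 1 / 4 := by
  rcases hp.eq_two_or_odd with rfl | hodd
  · rw [localDensity_two]
  rcases (by omega : p % 4 = 1 ∨ p % 4 = 3) with h | h
  · refine (localDensity_of_mod_four_eq_one hθ hθ' hp h).2.trans ?_
    have h5 : (5 : ℝ) ≤ p := by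
      have := hp.one_lt
      exact_mod_cast (by omega : 5 ≤ p)
    have h1 : 1 / (p : ℝ) ≤ 1 / 5 := one_div_le_one_div_of_le (by norm_num) h5
    have h2 : 1 / (p : ℝ) ^ 2 = (1 / (p : ℝ)) ^ 2 := by rw [one_div_pow]
    have h3 : 0 ≤ 1 / (p : ℝ) := by positivity
    rw [h2]
    nlinarith
  · rw [localDensity_of_mod_four_eq_three θ hp h]
    norm_num

/-- With y = 1/p and p ≡ 1 mod 4, the density is at most y + y^2 ≤ 2y, whence y + y^2 + 2(2y)^2 = y
+ 9y^2. The left side is the exponent lost in `exp_neg_le_one_sub`. -/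
theorem localDensity_add_sq_le {θ : ℝ} (hθ : 0 ≤ θ) (hθ' : θ ≤ 1 / 2) {p : ℕ} (hp : p.Prime) :
    localDensity θ p + 2 * localDensity θ p ^ 2
      ≤ (if p % 4 = 1 then 1 / (p : ℝ) else 0) + 9 * (1 / (p : ℝ) ^ 2) := by
  rcases hp.eq_two_or_odd with rfl | hodd
  · rw [localDensity_two]; norm_num
  rcases (by omega : p % 4 = 1 ∨ p % 4 = 3) with h | h
  · rw [if_pos h]
    have h2 : 1 / (p : ℝ) ^ 2 = (1 / (p : ℝ)) ^ 2 := by rw [one_div_pow]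
    have hle := (localDensity_of_mod_four_eq_one hθ hθ' hp h).2
    have h0 := localDensity_nonneg hθ p
    have h3 : 0 ≤ 1 / (p : ℝ) := by positivity
    have h4 : 1 / (p : ℝ) ≤ 1 := by
      rw [div_le_one (by exact_mod_cast hp.pos)]
      exact_mod_cast hp.one_lt.le
    rw [h2] at hle ⊢
    generalize 1 / (p : ℝ) = y at *
    have h5 : localDensity θ p ≤ 2 * y := by nlinarith
    nlinarith
  · rw [localDensity_of_mod_four_eq_three θ hp h]
    have : 0 ≤ 1 / (p : ℝ) ^ 2 := by positivity
    simp [h]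

theorem sum_siftingPrimes_one_mod_four (t : ℕ) :
    ∑ p ∈ siftingPrimes t, (if p % 4 = 1 then 1 / (p : ℝ) else 0)
      = ∑ p ∈ range (2 ^ 2 ^ t) with p.Prime ∧ p % 4 = 1, 1 / (p : ℝ) := by
  rw [siftingPrimes, ← sum_filter, filter_filter]

theorem exists_sum_one_div_sq_le : ∃ C : ℝ, 0 ≤ C ∧ ∀ s : Finset ℕ, ∑ n ∈ s, 1 / (n : ℝ) ^ 2 ≤ C := by
  have hs : Summable fun n : ℕ => 1 / (n : ℝ) ^ 2 := Real.summable_one_div_nat_pow.2 one_lt_two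
  exact ⟨_, tsum_nonneg fun n => by positivity, fun s =>
    hs.sum_le_tsum s fun n _ => by positivity⟩

/-- One step in t raises the Mertens sum by log 2 / 2 up to a bounded error, so all layers have
uniformly bounded mass. -/
theorem exists_sum_primeLayer_le :
    ∃ L : ℝ, 0 ≤ L ∧ ∀ θ : ℝ, 0 ≤ θ → θ ≤ 1 / 2 → ∀ i : ℕ,
      ∑ p ∈ primeLayer i, (localDensity θ p + 2 * localDensity θ p ^ 2) ≤ L := by
  obtain ⟨C, hC⟩ := exists_abs_sum_prime_one_mod_four_sub_le
  obtain ⟨D, hD0, hD⟩ := exists_sum_one_div_sq_le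
  have hC0 : 0 ≤ C := (abs_nonneg _).trans (hC 0)
  have hl : 0 < Real.log 2 := Real.log_pos one_lt_two
  refine ⟨Real.log 2 / 2 + 2 * C + 9 * D, by positivity, fun θ hθ hθ' i => ?_⟩
  have h1 : ∑ p ∈ primeLayer i, (localDensity θ p + 2 * localDensity θ p ^ 2)
      ≤ ∑ p ∈ primeLayer i, (if p % 4 = 1 then 1 / (p : ℝ) else 0)
        + 9 * ∑ p ∈ primeLayer i, 1 / (p : ℝ) ^ 2 := by
    rw [mul_sum, ← sum_add_distrib]
    exact sum_le_sum fun p hp => localDensity_add_sq_le hθ hθ' (mem_filter.1 hp).2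
  have h2 := sum_siftingPrimes_one_mod_four (i + 1)
  rw [siftingPrimes_succ, sum_union (disjoint_siftingPrimes_primeLayer i),
    sum_siftingPrimes_one_mod_four i] at h2
  have h3 := abs_le.1 (hC i)
  have h4 := abs_le.1 (hC (i + 1))
  push_cast at h4
  have h5 := hD (primeLayer i)
  linarith [h3.1, h4.2]

theorem exp_neg_sum_le_prod {θ : ℝ} (hθ : 0 ≤ θ) (hθ' : θ ≤ 1 / 2) {s : Finset ℕ}
    (hs : ∀ p ∈ s, p.Prime) :
    Real.exp (-∑ p ∈ s, (localDensity θ p + 2 * localDensity θ p ^ 2))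
      ≤ ∏ p ∈ s, (1 - localDensity θ p) := by
  rw [← sum_neg_distrib, Real.exp_sum]
  exact prod_le_prod (fun p _ => (Real.exp_pos _).le) fun p hp =>
    exp_neg_le_one_sub
      ((localDensity_le hθ hθ' (hs p hp)).trans (by norm_num))

theorem exp_log_two_div_two (t : ℕ) : Real.exp (t * Real.log 2 / 2) = √(2 ^ t) := by
  rw [Real.exp_half, ← Real.log_pow, Real.exp_log (by positivity)]

theorem exists_prod_one_sub_localDensity_bounds :
    ∃ c C : ℝ, 0 < c ∧ 0 < C ∧ ∀ θ : ℝ, 0 ≤ θ → θ ≤ 1 / 2 → ∀ t : ℕ,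
      c / √(2 ^ t) ≤ ∏ p ∈ siftingPrimes t, (1 - localDensity θ p) ∧
        ∏ p ∈ siftingPrimes t, (1 - localDensity θ p) ≤ C / √(2 ^ t) := by
  obtain ⟨K, hK⟩ := exists_abs_sum_prime_one_mod_four_sub_le
  obtain ⟨D, hD0, hD⟩ := exists_sum_one_div_sq_le
  refine ⟨Real.exp (-(K + 9 * D)), Real.exp K, Real.exp_pos _, Real.exp_pos _,
    fun θ hθ hθ' t => ?_⟩
  have hprime : ∀ p ∈ siftingPrimes t, p.Prime := fun p hp => (mem_filter.1 hp).2
  have hA := abs_le.1 (hK t)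
  rw [← sum_siftingPrimes_one_mod_four] at hA
  rw [← exp_log_two_div_two, ← Real.exp_sub, ← Real.exp_sub]
  constructor
  · refine le_trans (Real.exp_le_exp.2 ?_) (exp_neg_sum_le_prod hθ hθ' hprime)
    have h1 : ∑ p ∈ siftingPrimes t, (localDensity θ p + 2 * localDensity θ p ^ 2)
        ≤ ∑ p ∈ siftingPrimes t, (if p % 4 = 1 then 1 / (p : ℝ) else 0)
          + 9 * ∑ p ∈ siftingPrimes t, 1 / (p : ℝ) ^ 2 := by
      rw [mul_sum, ← sum_add_distrib]
      exact sum_le_sum fun p hp => localDensity_add_sq_le hθ hθ' (hprime p hp)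
    have h2 := hD (siftingPrimes t)
    linarith [hA.2]
  · have h1 : ∏ p ∈ siftingPrimes t, (1 - localDensity θ p)
        ≤ Real.exp (-∑ p ∈ siftingPrimes t, localDensity θ p) := by
      rw [← sum_neg_distrib, Real.exp_sum]
      refine prod_le_prod (fun p hp => ?_) fun p _ => Real.one_sub_le_exp_neg _
      linarith [localDensity_le hθ hθ' (hprime p hp)]
    refine h1.trans (Real.exp_le_exp.2 ?_)
    have h2 : ∑ p ∈ siftingPrimes t, (if p % 4 = 1 then 1 / (p : ℝ) else 0)
        ≤ ∑ p ∈ siftingPrimes t, localDensity θ p := by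
      refine sum_le_sum fun p hp => ?_
      split_ifs with h
      · exact (localDensity_of_mod_four_eq_one hθ hθ' (hprime p hp) h).1
      · exact localDensity_nonneg hθ p
    linarith [hA.1]

/-- The truncation order of the sieve in the layer `i` out of `t`. -/
def truncOrder (m t i : ℕ) : ℕ := 2 * (m + (t - i)) + 1

/-- The orders for different i are distinct and all exceed `m`, so the sum is part of a tail of the
exponential series. Their growth towards small i is affordable because those layers contain small
primes. -/
theorem exists_sum_pow_div_factorial_truncOrder_le (L : ℝ) {ε : ℝ} (hε : 0 < ε) :
    ∃ m : ℕ, ∀ t : ℕ,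
      ∑ i ∈ range t, L ^ truncOrder m t i / (truncOrder m t i).factorial ≤ ε := by
  obtain ⟨s, hs⟩ := summable_iff_vanishing_norm.1 (Real.summable_pow_div_factorial L) ε hε
  refine ⟨s.sup id, fun t => ?_⟩
  have hinj : Set.InjOn (truncOrder (s.sup id) t) (range t) := by
    intro i hi j hj h
    have := mem_range.1 hi
    have := mem_range.1 hj
    simp only [truncOrder] at h
    omega
  have h := hs ((range t).image (truncOrder (s.sup id) t)) (by
    rw [disjoint_right]
    intro k hk hk'
    obtain ⟨i, -, rfl⟩ := mem_image.1 hk'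
    have : id (truncOrder (s.sup id) t i) ≤ s.sup id := le_sup hk
    simp only [truncOrder, id] at this
    omega)
  rw [sum_image hinj] at h
  exact (le_abs_self _).trans h.le

theorem sum_two_pow_mul_sub_le (t : ℕ) : ∑ i ∈ range t, 2 ^ i * (t - i) ≤ 2 * 2 ^ t := by
  induction t with
  | zero => simp
  | succ t ih =>
    have h1 : ∑ i ∈ range (t + 1), 2 ^ i * (t + 1 - i)
        = ∑ i ∈ range t, 2 ^ i * (t - i) + ∑ i ∈ range (t + 1), 2 ^ i := by
      rw [sum_range_succ, sum_range_succ, ← add_assoc, ← sum_add_distrib]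
      congr 1
      · refine sum_congr rfl fun i hi => ?_
        rw [Nat.succ_sub (mem_range.1 hi).le, Nat.mul_succ]
      · simp
    have h2 : ∑ i ∈ range (t + 1), 2 ^ i ≤ 2 ^ (t + 1) := (Nat.geomSum_lt le_rfl (by simp)).le
    rw [h1, pow_succ]
    rw [pow_succ] at h2
    omega

theorem prod_sum_elemSum_primeLayer_le (m t : ℕ) :
    ∏ i ∈ range t, ∑ k ∈ range (truncOrder m t i + 1), elemSum (fun _ => 2) (primeLayer i) k
      ≤ ((2 : ℝ) ^ 2 ^ t) ^ (8 * m + 20) := by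
  have h1 : ∀ i, ∑ k ∈ range (truncOrder m t i + 1), elemSum (fun _ => 2) (primeLayer i) k
      ≤ (2 : ℝ) ^ (4 * 2 ^ i * truncOrder m t i) := by
    intro i
    refine (sum_elemSum_le_pow (fun _ _ => by norm_num) _).trans ?_
    rw [pow_mul]
    refine pow_le_pow_left₀ (by positivity) ?_ _
    rw [sum_const, nsmul_eq_mul]
    have hcard : #(primeLayer i) ≤ 2 ^ 2 ^ (i + 1) := by
      refine (card_filter_le _ _).trans ?_
      rw [Nat.card_Ico]
      exact Nat.sub_le _ _
    -- The remainder of layer i is thus at most 2 to the power 4·2^i times its order; summing over i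
    -- gives (8m + 4)2^t + 16·2^t in the exponent.
    have h2 : 1 + #(primeLayer i) * 2 ≤ 2 ^ (4 * 2 ^ i) := by
      have h3 : 1 ≤ 2 ^ 2 ^ (i + 1) := Nat.one_le_two_pow
      have h4 : 2 ^ (2 ^ (i + 1) + 2) ≤ 2 ^ (4 * 2 ^ i) := by
        refine Nat.pow_le_pow_right two_pos ?_
        have := Nat.one_le_two_pow (n := i)
        rw [pow_succ]
        omega
      rw [pow_add] at h4
      omega
    exact_mod_cast h2
  refine (prod_le_prod (fun i _ => sum_nonneg fun k _ =>
    elemSum_nonneg (fun _ _ => by norm_num) k) fun i _ => h1 i).trans ?_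
  rw [prod_pow_eq_pow_sum, ← pow_mul]
  refine pow_le_pow_right₀ one_le_two ?_
  have h2 := sum_two_pow_mul_sub_le t
  have h3 : ∑ i ∈ range t, 2 ^ i ≤ 2 ^ t := (Nat.geomSum_lt le_rfl (by simp)).le
  have h4 : ∑ i ∈ range t, 4 * 2 ^ i * truncOrder m t i
      = (8 * m + 4) * ∑ i ∈ range t, 2 ^ i + 8 * ∑ i ∈ range t, 2 ^ i * (t - i) := by
    rw [mul_sum, mul_sum, ← sum_add_distrib]
    refine sum_congr rfl fun i _ => ?_
    rw [truncOrder]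
    ring
  rw [h4]
  have h5 := Nat.mul_le_mul_left (8 * m + 4) h3
  nlinarith

theorem exists_sum_prod_one_sub_localWeight_bounds :
    ∃ K t₀ : ℕ, 0 < K ∧ ∀ θ : ℝ, 0 ≤ θ → θ ≤ 1 / 2 → ∀ t N : ℕ, t₀ ≤ t →
      (2 ^ 2 ^ t) ^ (2 * K) ≤ N →
      N * (∏ p ∈ siftingPrimes t, (1 - localDensity θ p)) / 4
        ≤ ∑ n ∈ Ioc 0 N, ∏ p ∈ siftingPrimes t, (1 - localWeight θ n p) ∧
      ∑ n ∈ Ioc 0 N, ∏ p ∈ siftingPrimes t, (1 - localWeight θ n p)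
        ≤ 3 * (N * ∏ p ∈ siftingPrimes t, (1 - localDensity θ p)) := by
  obtain ⟨L, hL0, hL⟩ := exists_sum_primeLayer_le
  obtain ⟨c, C, hc, -, hcC⟩ := exists_prod_one_sub_localDensity_bounds
  -- Each layer product is at least exp(-L), so dividing by it costs a factor exp(L) and leaves the
  -- 1/2 required by `brunHooley`.
  obtain ⟨m, hm⟩ := exists_sum_pow_div_factorial_truncOrder_le L
    (show 0 < Real.exp (-L) / 2 by positivity)
  obtain ⟨t₀, ht₀⟩ := pow_unbounded_of_one_lt (4 / c) (one_lt_two)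
  refine ⟨8 * m + 20, t₀, by omega, fun θ hθ hθ' t N ht hN => ?_⟩
  have hprime : ∀ p ∈ siftingPrimes t, p.Prime := fun p hp => (mem_filter.1 hp).2
  have hlayer : ∀ i, ∀ p ∈ primeLayer i, p.Prime := fun i p hp => (mem_filter.1 hp).2
  have hsmall : ∑ i ∈ range t, elemSum (localDensity θ) (primeLayer i) (truncOrder m t i)
      / ∏ p ∈ primeLayer i, (1 - localDensity θ p) ≤ 1 / 2 := by
    calc _ ≤ ∑ i ∈ range t, Real.exp L
            * (L ^ truncOrder m t i / (truncOrder m t i).factorial) := by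
          refine sum_le_sum fun i _ => ?_
          have hV : Real.exp (-L) ≤ ∏ p ∈ primeLayer i, (1 - localDensity θ p) :=
            (Real.exp_le_exp.2 (neg_le_neg (hL θ hθ hθ' i))).trans
              (exp_neg_sum_le_prod hθ hθ' (hlayer i))
          have hs : ∑ p ∈ primeLayer i, localDensity θ p ≤ L := by
            refine le_trans (sum_le_sum fun p _ => ?_) (hL θ hθ hθ' i)
            nlinarith [sq_nonneg (localDensity θ p)]
          have hs0 : 0 ≤ ∑ p ∈ primeLayer i, localDensity θ p :=
            sum_nonneg fun p _ => localDensity_nonneg hθ p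
          have hE : elemSum (localDensity θ) (primeLayer i) (truncOrder m t i)
              ≤ L ^ truncOrder m t i / (truncOrder m t i).factorial :=
            (elemSum_le_pow_div_factorial (fun p _ => localDensity_nonneg hθ p) _).trans
              (by gcongr)
          rw [div_le_iff₀ ((Real.exp_pos _).trans_le hV)]
          have h1 : 1 ≤ Real.exp L * ∏ p ∈ primeLayer i, (1 - localDensity θ p) := by
            have := mul_le_mul_of_nonneg_left hV (Real.exp_pos L).le
            rwa [← Real.exp_add, add_neg_cancel, Real.exp_zero] at this
          have h2 : 0 ≤ L ^ truncOrder m t i / (truncOrder m t i).factorial := by positivity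
          nlinarith
      _ ≤ 1 / 2 := by
          rw [← mul_sum]
          have := mul_le_mul_of_nonneg_left (hm t) (Real.exp_pos L).le
          rw [mul_div_assoc', ← Real.exp_add, add_neg_cancel, Real.exp_zero] at this
          exact this
  have hsieve := brunHooley (Ioc 0 N) (localWeight θ) (localDensity θ) (X := N)
    (Nat.cast_nonneg N) 2 (siftingPrimes t)
    (fun S hS => by
      simpa [Nat.modEq_one] using abs_sum_prod_localWeight_sub_le hθ hθ' N S
        (fun p hp => hprime p (hS hp)) 1 one_pos (fun p _ => Nat.coprime_one_left p) 0)
    (fun n p _ => localWeight_nonneg hθ n p) (fun n p _ => localWeight_le_one hθ' n p)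
    (fun p _ => localDensity_nonneg hθ p)
    (fun p hp => (localDensity_le hθ hθ' (hprime p hp)).trans_lt (by norm_num))
    primeLayer (truncOrder m t) (fun j => ⟨_, rfl⟩) (range t)
    (fun j hj => primeLayer_subset (mem_range.1 hj))
    (fun i _ j _ h => disjoint_primeLayer h) hsmall
  simp only [prod_primeLayer] at hsieve
  have hB := prod_sum_elemSum_primeLayer_le m t
  have hB0 : 0 ≤ ∏ i ∈ range t, ∑ k ∈ range (truncOrder m t i + 1),
      elemSum (fun _ => 2) (primeLayer i) k :=
    prod_nonneg fun i _ => sum_nonneg fun k _ => elemSum_nonneg (fun _ _ => by norm_num) k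
  set B := ∏ i ∈ range t, ∑ k ∈ range (truncOrder m t i + 1),
      elemSum (fun _ => 2) (primeLayer i) k
  set V := ∏ p ∈ siftingPrimes t, (1 - localDensity θ p)
  have hV := (hcC θ hθ hθ' t).1
  rw [card_range] at hsieve
  -- N ≥ Z^2 while B ≤ Z; the spare Z ≥ 2^(3t) absorbs t + 1 ≤ 2^t, the loss V ≥ c/2^t, and 4/c ≤
  -- 2^t, which is what `t₀` ensures.
  have hNB : (t + 1) * B ≤ N * V / 4 := by
    set Z : ℝ := ((2 : ℝ) ^ 2 ^ t) ^ (8 * m + 20)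
    have hN' : Z * Z ≤ N := by
      have : ((2 : ℝ) ^ 2 ^ t) ^ (2 * (8 * m + 20)) ≤ N := by exact_mod_cast hN
      rwa [two_mul, pow_add] at this
    have hZ : (2 : ℝ) ^ t * 2 ^ t * 2 ^ t ≤ Z := by
      have h1 : (2 : ℝ) ^ t ≤ 2 ^ 2 ^ t := pow_le_pow_right₀ one_le_two Nat.lt_two_pow_self.le
      calc (2 : ℝ) ^ t * 2 ^ t * 2 ^ t = (2 ^ t) ^ 3 := by ring
        _ ≤ (2 ^ 2 ^ t) ^ 3 := by gcongr
        _ ≤ Z := pow_le_pow_right₀ (one_le_pow₀ one_le_two) (by omega)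
    have ht1 : (t : ℝ) + 1 ≤ 2 ^ t := by exact_mod_cast Nat.lt_two_pow_self (n := t)
    have hc2 : 4 / c ≤ 2 ^ t := ht₀.le.trans (pow_le_pow_right₀ one_le_two ht)
    have hsqrt : √(2 ^ t) ≤ 2 ^ t := by
      rw [Real.sqrt_le_left (by positivity)]
      nlinarith [one_le_pow₀ (one_le_two (α := ℝ)) (n := t)]
    have hV2 : c / 2 ^ t ≤ V := by
      refine le_trans ?_ hV
      gcongr
    have hZ0 : 0 < Z := by positivity
    have h2t : (0 : ℝ) < 2 ^ t := by positivity
    have h1 : (t + 1) * B ≤ 2 ^ t * Z := mul_le_mul ht1 hB hB0 h2t.le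
    have h2 : 2 ^ t ≤ Z * (c / 2 ^ t) / 4 := by
      rw [div_le_iff₀ hc] at hc2
      rw [mul_div_assoc', div_div, le_div_iff₀ (by positivity)]
      have := mul_le_mul_of_nonneg_right hZ hc.le
      nlinarith [mul_le_mul_of_nonneg_left hc2 (mul_pos h2t h2t).le]
    have h3 : Z * (Z * (c / 2 ^ t) / 4) ≤ N * V / 4 := by
      have : Z * Z * (c / 2 ^ t) ≤ N * V := mul_le_mul hN' hV2 (by positivity) (Nat.cast_nonneg N)
      linarith
    have h4 := mul_le_mul_of_nonneg_right h2 hZ0.le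
    linarith
  have hB1 : B ≤ (t + 1) * B := le_mul_of_one_le_left hB0 (by linarith [Nat.cast_nonneg (α := ℝ) t])
  have hV0 : 0 ≤ V := le_trans (by positivity) hV
  have hNV : 0 ≤ N * V := by positivity
  constructor <;> linarith [hsieve.1, hsieve.2]

end Layers

/-! ### Comparison of the divisor function with the sieve products, and conclusion. -/

section DivisorCount

open Finset

theorem prod_one_sub_localWeight_zero (n : ℕ) (s : Finset ℕ) :
    ∏ p ∈ s, (1 - localWeight 0 n p) = 1 / 2 ^ #{p ∈ s | p ∣ n ^ 2 + 1} := by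
  rw [one_div, ← inv_pow, ← prod_const, prod_filter]
  refine prod_congr rfl fun p _ => ?_
  rw [localWeight]
  split_ifs <;> norm_num

theorem one_div_card_divisors_le (n t : ℕ) :
    1 / ((n ^ 2 + 1).divisors.card : ℝ) ≤ ∏ p ∈ siftingPrimes t, (1 - localWeight 0 n p) := by
  rw [prod_one_sub_localWeight_zero]
  have h0 : n ^ 2 + 1 ≠ 0 := by positivity
  refine one_div_le_one_div_of_le (by positivity) ?_
  have h : 2 ^ #{p ∈ siftingPrimes t | p ∣ n ^ 2 + 1} ≤ #(n ^ 2 + 1).divisors := by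
    rw [Nat.card_divisors h0, ← prod_const]
    have hsub : {p ∈ siftingPrimes t | p ∣ n ^ 2 + 1} ⊆ (n ^ 2 + 1).primeFactors := by
      intro p hp
      obtain ⟨h1, h2⟩ := mem_filter.1 hp
      exact Nat.mem_primeFactors.2 ⟨(mem_filter.1 h1).2, h2, h0⟩
    refine le_trans (prod_le_prod' fun p hp => ?_)
      (prod_le_prod_of_subset_of_one_le' hsub fun p _ _ => Nat.le_add_left 1 _)
    have := Nat.mem_primeFactors.1 (hsub hp)
    have := this.1.factorization_pos_of_dvd h0 this.2.1
    omega
  exact_mod_cast h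

/-- With θ = 1/2 the product vanishes as soon as some p^2 divides n^2+1 with p < z = 2^(2^t).
Otherwise each small prime contributes exactly 2 to τ, and the large ones at most 2^M: their
exponents e sum to at most `M` by size, and e + 1 ≤ 2^e. -/
theorem prod_one_sub_localWeight_half_le {n t M : ℕ} (hM : n ^ 2 + 1 ≤ (2 ^ 2 ^ t) ^ M) :
    1 / 2 ^ M * ∏ p ∈ siftingPrimes t, (1 - localWeight (1 / 2) n p)
      ≤ 1 / ((n ^ 2 + 1).divisors.card : ℝ) := by
  have h0 : n ^ 2 + 1 ≠ 0 := by positivity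
  by_cases hsq : ∃ p ∈ siftingPrimes t, p ^ 2 ∣ n ^ 2 + 1
  · obtain ⟨p, hp, hp2⟩ := hsq
    have : 1 - localWeight (1 / 2) n p = 0 := by
      rw [localWeight, if_pos hp2, if_pos ((dvd_pow_self p two_ne_zero).trans hp2)]
      norm_num
    rw [prod_eq_zero hp this, mul_zero]
    positivity
  push Not at hsq
  have e : ∏ p ∈ siftingPrimes t, (1 - localWeight (1 / 2) n p)
      = 1 / 2 ^ #{p ∈ siftingPrimes t | p ∣ n ^ 2 + 1} := by
    rw [← prod_one_sub_localWeight_zero]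
    refine prod_congr rfl fun p hp => ?_
    rw [localWeight, localWeight, if_neg (hsq p hp)]
    ring
  rw [e, div_mul_div_comm, mul_one, ← pow_add]
  have hcard : 0 < #(n ^ 2 + 1).divisors := card_pos.2 ⟨1, by simp⟩
  refine one_div_le_one_div_of_le (by exact_mod_cast hcard) ?_
  set m := n ^ 2 + 1
  set Q := m.primeFactors \ siftingPrimes t
  have hlarge : ∀ p ∈ Q, 2 ^ 2 ^ t ≤ p := by
    intro p hp
    obtain ⟨h1, h2⟩ := mem_sdiff.1 hp
    by_contra h
    exact h2 (mem_filter.2 ⟨mem_range.2 (not_le.1 h), Nat.prime_of_mem_primeFactors h1⟩)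
  have hexp : ∑ p ∈ Q, m.factorization p ≤ M := by
    have h1 : (2 ^ 2 ^ t) ^ ∑ p ∈ Q, m.factorization p ≤ (2 ^ 2 ^ t) ^ M := by
      refine le_trans ?_ hM
      calc (2 ^ 2 ^ t) ^ ∑ p ∈ Q, m.factorization p
          = ∏ p ∈ Q, (2 ^ 2 ^ t) ^ m.factorization p := (prod_pow_eq_pow_sum _ _ _).symm
        _ ≤ ∏ p ∈ Q, p ^ m.factorization p :=
            prod_le_prod' fun p hp => Nat.pow_le_pow_left (hlarge p hp) _
        _ ≤ ∏ p ∈ m.primeFactors, p ^ m.factorization p :=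
            prod_le_prod_of_subset_of_one_le' sdiff_subset fun p hp _ =>
              Nat.one_le_pow _ _ (Nat.pos_of_mem_primeFactors hp)
        _ = m := Nat.prod_factorization_pow_eq_self h0
    exact (Nat.pow_le_pow_iff_right (Nat.one_lt_two_pow (by positivity))).1 h1
  have h : #m.divisors ≤ 2 ^ (M + #{p ∈ siftingPrimes t | p ∣ m}) := by
    rw [Nat.card_divisors h0, ← prod_sdiff (inter_subset_left (s₂ := siftingPrimes t)),
      sdiff_inter_self_left, pow_add]
    refine Nat.mul_le_mul ?_ ?_
    · calc ∏ p ∈ Q, (m.factorization p + 1) ≤ ∏ p ∈ Q, 2 ^ m.factorization p :=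
            prod_le_prod' fun p _ => Nat.lt_two_pow_self
        _ = 2 ^ ∑ p ∈ Q, m.factorization p := prod_pow_eq_pow_sum _ _ _
        _ ≤ 2 ^ M := Nat.pow_le_pow_right two_pos hexp
    · have hsub : m.primeFactors ∩ siftingPrimes t ⊆ {p ∈ siftingPrimes t | p ∣ m} := by
        intro p hp
        obtain ⟨h1, h2⟩ := mem_inter.1 hp
        exact mem_filter.2 ⟨h2, Nat.dvd_of_mem_primeFactors h1⟩
      refine le_trans (prod_le_prod' (g := fun _ => 2) fun p hp => ?_) ?_
      · obtain ⟨h1, h2⟩ := mem_inter.1 hp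
        have h3 : m.factorization p < 2 := by
          by_contra h3
          exact hsq p h2 (((Nat.prime_of_mem_primeFactors h1).pow_dvd_iff_le_factorization h0).2
            (not_lt.1 h3))
        omega
      · rw [prod_const]
        exact Nat.pow_le_pow_right two_pos (card_le_card hsub)
  exact_mod_cast h

theorem F_eq_sum_Ioc (x : ℝ) :
    F x = ∑ n ∈ Ioc 0 ⌊x⌋₊, 1 / ((n ^ 2 + 1).divisors.card : ℝ) := rfl

theorem half_le_F {x : ℝ} (hx : 2 ≤ x) : 1 / 2 ≤ F x := by
  have h1 : 1 ∈ Ioc 0 ⌊x⌋₊ :=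
    mem_Ioc.2 ⟨one_pos, Nat.le_floor (by push_cast; linarith)⟩
  rw [F_eq_sum_Ioc]
  refine le_trans (le_of_eq ?_) (single_le_sum (fun n _ => by positivity) h1)
  have : #(1 ^ 2 + 1 : ℕ).divisors = 2 := by decide
  rw [this]
  norm_num

theorem F_le {x : ℝ} (hx : 0 ≤ x) : F x ≤ x := by
  rw [F_eq_sum_Ioc]
  calc _ ≤ ∑ n ∈ Ioc 0 ⌊x⌋₊, (1 : ℝ) := by
        refine sum_le_sum fun n _ => ?_
        have hcard : 0 < #(n ^ 2 + 1).divisors := card_pos.2 ⟨1, by simp⟩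
        exact div_le_one_of_le₀ (by exact_mod_cast hcard) (by positivity)
    _ = (⌊x⌋₊ : ℝ) := by simp
    _ ≤ x := Nat.floor_le hx

/-- The largest admissible t works: passing from t to t + 1 squares 2^(2^t), which doubles the
exponent 2K. -/
theorem exists_scale {K t₀ N : ℕ} (hK : 0 < K) (hN : (2 ^ 2 ^ t₀) ^ (2 * K) ≤ N) :
    ∃ t, t₀ ≤ t ∧ (2 ^ 2 ^ t) ^ (2 * K) ≤ N ∧ N < (2 ^ 2 ^ t) ^ (4 * K) := by
  have hex : ∃ t, N < (2 ^ 2 ^ t) ^ (2 * K) := by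
    refine ⟨N, ?_⟩
    calc N < 2 ^ N := Nat.lt_two_pow_self
      _ < 2 ^ 2 ^ N := Nat.pow_lt_pow_right one_lt_two Nat.lt_two_pow_self
      _ ≤ _ := Nat.le_self_pow (by omega) _
  classical
  have hs := Nat.find_spec hex
  have hlt : t₀ < Nat.find hex := by
    by_contra h
    have := Nat.pow_le_pow_left (two_pow_two_pow_le (not_lt.1 h)) (2 * K)
    omega
  obtain ⟨t, ht⟩ : ∃ t, Nat.find hex = t + 1 := ⟨Nat.find hex - 1, by omega⟩
  refine ⟨t, by omega, not_lt.1 (Nat.find_min hex (by omega)), ?_⟩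
  rw [ht] at hs
  refine hs.trans_le (le_of_eq ?_)
  rw [← pow_mul, ← pow_mul, pow_succ]
  congr 1
  ring

theorem exists_eventual_bounds :
    ∃ c C X : ℝ, 0 < c ∧ 0 < C ∧ 2 ≤ X ∧ ∀ x : ℝ, X ≤ x →
      c * (x / √(Real.log x)) ≤ F x ∧ F x ≤ C * (x / √(Real.log x)) := by
  obtain ⟨K, t₀, hK, hmain⟩ := exists_sum_prod_one_sub_localWeight_bounds
  obtain ⟨c, C, hc, hC, hV⟩ := exists_prod_one_sub_localDensity_bounds
  -- 8K comes from n^2+1 ≤ (z^(4K))^2; the 8 is 4 from the sieve times 2 from ⌊x⌋ ≥ x/2; √(4K) comes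
  -- from log x ≤ 4K·2^t.
  refine ⟨1 / 2 ^ (8 * K) * (c / 8), 3 * C * √(4 * K), max 2 ((2 ^ 2 ^ t₀) ^ (2 * K) : ℕ),
    by positivity, by positivity, le_max_left _ _, fun x hx => ?_⟩
  have hx2 : 2 ≤ x := (le_max_left _ _).trans hx
  have hx0 : 0 ≤ x := by linarith
  obtain ⟨t, ht, htN, hNt⟩ := exists_scale hK (Nat.le_floor ((le_max_right _ _).trans hx))
  set N := ⌊x⌋₊ with hNdef
  have hNx : (N : ℝ) ≤ x := Nat.floor_le hx0
  have hxN : x < N + 1 := Nat.lt_floor_add_one x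
  have hxN2 : x / 2 ≤ N := by linarith
  have hlog : 0 < Real.log x := Real.log_pos (by linarith)
  have hl2 := Real.log_two_gt_d9
  have hl2' := Real.log_two_lt_d9
  have hl2pos : 0 < Real.log 2 := by linarith
  have hK1 : (1 : ℝ) ≤ K := by exact_mod_cast hK
  have h2t : (0 : ℝ) < 2 ^ t := by positivity
  have hlow : (2 : ℝ) ^ t ≤ Real.log x := by
    have h1 : ((2 : ℝ) ^ 2 ^ t) ^ (2 * K) ≤ x := le_trans (by exact_mod_cast htN) hNx
    have h2 := Real.log_le_log (by positivity) h1
    rw [Real.log_pow, Real.log_pow] at h2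
    push_cast at h2
    nlinarith [mul_nonneg (sub_nonneg.2 hK1) h2t.le]
  have hup : Real.log x ≤ 4 * K * 2 ^ t := by
    have h1 : x ≤ ((2 : ℝ) ^ 2 ^ t) ^ (4 * K) := by
      have : ((N + 1 : ℕ) : ℝ) ≤ (((2 ^ 2 ^ t) ^ (4 * K) : ℕ) : ℝ) := by exact_mod_cast hNt
      push_cast at this
      linarith
    have h2 := Real.log_le_log (by linarith) h1
    rw [Real.log_pow, Real.log_pow] at h2
    push_cast at h2
    nlinarith [mul_pos (show (0 : ℝ) < K by linarith) h2t]
  have hs1 : √(2 ^ t) ≤ √(Real.log x) := Real.sqrt_le_sqrt hlow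
  have hs2 : √(Real.log x) ≤ √(4 * K) * √(2 ^ t) := by
    rw [← Real.sqrt_mul (by positivity)]
    exact Real.sqrt_le_sqrt hup
  have hst : 0 < √((2 : ℝ) ^ t) := Real.sqrt_pos.2 h2t
  have hsx : 0 < √(Real.log x) := Real.sqrt_pos.2 hlog
  rw [F_eq_sum_Ioc, ← hNdef]
  constructor
  · have hm := (hmain (1 / 2) (by norm_num) le_rfl t N ht htN).1
    have hv := (hV (1 / 2) (by norm_num) le_rfl t).1
    have hpt : 1 / 2 ^ (8 * K) * ∑ n ∈ Ioc 0 N,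
        ∏ p ∈ siftingPrimes t, (1 - localWeight (1 / 2) n p)
        ≤ ∑ n ∈ Ioc 0 N, 1 / ((n ^ 2 + 1).divisors.card : ℝ) := by
      rw [mul_sum]
      refine sum_le_sum fun n hn => prod_one_sub_localWeight_half_le ?_
      have hnN := (mem_Ioc.1 hn).2
      have h1 : n + 1 ≤ (2 ^ 2 ^ t) ^ (4 * K) := by omega
      calc n ^ 2 + 1 ≤ (n + 1) ^ 2 := by nlinarith
        _ ≤ ((2 ^ 2 ^ t) ^ (4 * K)) ^ 2 := Nat.pow_le_pow_left h1 2
        _ = (2 ^ 2 ^ t) ^ (8 * K) := by rw [← pow_mul]; congr 1; ring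
    refine le_trans ?_ hpt
    rw [mul_assoc]
    refine mul_le_mul_of_nonneg_left (le_trans ?_ hm) (by positivity)
    have h1 : c / √(Real.log x) ≤ c / √(2 ^ t) := by gcongr
    have h2 : x / 2 * (c / √(Real.log x)) ≤ N * _ :=
      mul_le_mul hxN2 (h1.trans hv) (by positivity) (Nat.cast_nonneg N)
    calc c / 8 * (x / √(Real.log x)) = x / 2 * (c / √(Real.log x)) / 4 := by ring
      _ ≤ _ := by linarith
  · have hm := (hmain 0 le_rfl (by norm_num) t N ht htN).2
    have hv := (hV 0 le_rfl (by norm_num) t).2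
    refine (sum_le_sum fun n _ => one_div_card_divisors_le n t).trans (hm.trans ?_)
    have h1 : C / √(2 ^ t) ≤ C * √(4 * K) / √(Real.log x) := by
      rw [div_le_div_iff₀ hst hsx, mul_assoc]
      exact mul_le_mul_of_nonneg_left hs2 hC.le
    have h2 : (N : ℝ) * _ ≤ x * (C * √(4 * K) / √(Real.log x)) :=
      mul_le_mul hNx (hv.trans h1) ?_ hx0
    · calc _ ≤ 3 * (x * (C * √(4 * K) / √(Real.log x))) := by linarith
        _ = _ := by ring
    · refine prod_nonneg fun p hp => ?_
      linarith [localDensity_le le_rfl (by norm_num : (0 : ℝ) ≤ 1 / 2) (mem_filter.1 hp).2]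

end DivisorCount

theorem theorem1p2 :
    ∃ c C : ℝ, 0 < c ∧ 0 < C ∧ ∀ x : ℝ, 2 ≤ x →
      c * (x / (Real.log x) ^ ((1 : ℝ) / 2)) ≤ F x ∧
        F x ≤ C * (x / (Real.log x) ^ ((1 : ℝ) / 2)) := by
  obtain ⟨c, C, X, hc, hC, hX, h⟩ := exists_eventual_bounds
  have hl2 : 0 < Real.log 2 := Real.log_pos one_lt_two
  have hX0 : 0 < X := by linarith
  -- The second entries cover 2 ≤ x < X, where the trivial bounds 1/2 ≤ F(x) ≤ x suffice.
  refine ⟨min c (√(Real.log 2) / (2 * X)), max C √(Real.log X),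
    lt_min hc (by positivity), lt_max_of_lt_left hC, fun x hx => ?_⟩
  rw [← Real.sqrt_eq_rpow]
  have hx0 : 0 < x := by linarith
  have hlog : 0 < Real.log x := Real.log_pos (by linarith)
  have hs : 0 < √(Real.log x) := Real.sqrt_pos.2 hlog
  have hpos : 0 ≤ x / √(Real.log x) := by positivity
  rcases le_or_gt X x with hxX | hxX
  · exact ⟨(mul_le_mul_of_nonneg_right (min_le_left _ _) hpos).trans (h x hxX).1,
      (h x hxX).2.trans (mul_le_mul_of_nonneg_right (le_max_left _ _) hpos)⟩
  · constructor
    · refine (mul_le_mul_of_nonneg_right (min_le_right _ _) hpos).trans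
        (le_trans ?_ (half_le_F hx))
      have h1 : √(Real.log 2) ≤ √(Real.log x) :=
        Real.sqrt_le_sqrt (Real.log_le_log two_pos hx)
      rw [div_mul_div_comm, div_le_div_iff₀ (by positivity) two_pos]
      have := mul_le_mul h1 hxX.le hx0.le hs.le
      linarith
    · refine (F_le hx0.le).trans
        (le_trans ?_ (mul_le_mul_of_nonneg_right (le_max_right _ _) hpos))
      have h1 : √(Real.log x) ≤ √(Real.log X) :=
        Real.sqrt_le_sqrt (Real.log_le_log hx0 hxX.le)
      rw [mul_div_assoc', le_div_iff₀ hs, mul_comm]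
      exact mul_le_mul_of_nonneg_right h1 hx0.le
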